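/- Let $G(s)=C_G(sI-A_G)^{-1}B_G+D_G$ be a stable, real-rational, proper transfer function and $F(s)=C_F(sI-A_F)^{-1}B_F$ a stable, real-rational, strictly proper transfer function (single input, single output; $A_G,A_F$ have all eigenvalues in the open left half plane). Let $h>0$, and let $m\ge 0$ and $L\ge 1$ be integers. For a stable real-rational proper discrete-time filter $K(z)$ consider the multirate error system $$\mathcal E_{\mathrm{mr}}=\bigl(e^{-mhs}G-\mathcal H_{h/L}\,K\,(\uparrow L)\,\mathcal S_h\bigr)F ,$$ where $\mathcal S_h$ is the ideal sampler $(\mathcal S_hu)[n]=u(nh)$, $\uparrow L$ is the upsampler $x\mapsto(x[0],0,\dots,0,x[1],0,\dots)$ ($L-1$ zeros between consecutive entries), $\mathcal H_{h/L}$ is the zero-order hold with period $h/L$, and $e^{-mhs}$ is the delay by $mh$. The system $\mathcal E_{\mathrm{mr}}$ is $h$-periodic; its lifted system $\widetilde{\mathcal E}_{\mathrm{mr}}$ is the discrete-time system acting on sequences of functions on $[0,h)$ obtained by cutting signals into pieces of length $h$, with transfer function $\widetilde{\mathcal E}_{\mathrm{mr}}(z)=\sum_{k\ge0}z^{-k}\hat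 E_k$, where $\hat E_k$ maps $w\in L^2[0,h)$ to the restriction to $[kh,(k+1)h)$, shifted back to $[0,h)$, of the response of $\mathcal E_{\mathrm{mr}}$ to $w$ continued by zero. For $|z|=1$ the $\hat E_k$ are bounded on $L^2[0,h)$, the series converges in operator norm, and $\|\widetilde{\mathcal E}_{\mathrm{mr}}(z)\|$ denotes the operator norm on $L^2[0,h)$. For a discrete-time system $P(z)=C(zI-A)^{-1}B+D$ let $\mathbf{lift}(P,N)$ be the $N\times N$ system with state-space matrices $A^N$, $[A^{N-1}B,\dots,AB,B]$, $[C^\top,(CA)^\top,\dots,(CA^{N-1})^\top]^\top$ and the lower triangular Toeplitz matrix with first column $[D,CB,CAB,\dots,CA^{N-2}B]^\top$, and for a continuous-time system let $\mathbf{c2d}\bigl((A,B,C,D),\tau\bigr)=(e^{A\tau},\int_0^\tau e^{At}B\,dt,C,D)$. For $N=Lp$, $p\ge1$, put $G_N=\mathbf{lift}(\mathbf{c2d}(G,h/N),N)$, $F_N=\mathbf{lift}(\mathbf{c2d}(F,h/N),N)$, $S_N=[1,0,\dots,0]\in\mathbb R^{1\times N}$, $\widetilde H_N=\mathbf{blkdiag}\{\mathbf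 1_p,\dots,\mathbf 1_p\}\in\mathbb R^{N\times L}$ with $\mathbf 1_p=[1,\dots,1]^\top\in\mathbb R^p$, $\widetilde K(z)=\mathbf{lift}(K(z),L)\,[1,0,\dots,0]^\top$, and $$E_{\mathrm{mr},N}(z)=\bigl(z^{-m}G_N(z)-\widetilde H_N\widetilde K(z)S_N\bigr)F_N(z).$$ Then for each fixed $\widetilde K$ (equivalently, each fixed $K$) and each $\omega\in[0,2\pi/h)$, $$\|E_{\mathrm{mr},N}(e^{\mathrm j\omega h})\|\to\|\widetilde{\mathcal E}_{\mathrm{mr}}(e^{\mathrm j\omega h})\|\qquad\text{as }N=Lp\to\infty,$$ where the norm on the left is the largest singular value. The convergence is uniform in $\omega\in[0,2\pi/h)$ and $\widetilde K$ in any set of such stable filters that is compact in the $H^\infty$ norm (uniform convergence on the unit circle). -/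

import Mathlib

open MeasureTheory Filter Topology

noncomputable section

namespace Multirate

/-- Real state-space matrices `(A, B, C, D)` with state index `σ`, input index `ι`
and output index `o`. -/
structure StateSpace (σ ι o : Type) where
  A : Matrix σ σ ℝ
  B : Matrix σ ι ℝ
  C : Matrix o σ ℝ
  D : Matrix o ι ℝ

/-- A real matrix regarded as a complex matrix. -/
def toC {α β : Type} (M : Matrix α β ℝ) : Matrix α β ℂ := M.map (fun x : ℝ => (x : ℂ))

/-- A single-input single-output system of order `n`. -/
abbrev SISO (n : ℕ) := StateSpace (Fin n) Unit Unit

namespace StateSpace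

/-- The transfer function `C (z I - A)⁻¹ B + D`. -/
def transfer {σ ι o : Type} [Fintype σ] [DecidableEq σ] (S : StateSpace σ ι o) (z : ℂ) :
    Matrix o ι ℂ :=
  toC S.C * (z • (1 : Matrix σ σ ℂ) - toC S.A)⁻¹ * toC S.B + toC S.D

/-- Continuous-time stability: all eigenvalues of `A` lie in the open left half plane. -/
def IsHurwitz {σ ι o : Type} [Fintype σ] [DecidableEq σ] (S : StateSpace σ ι o) : Prop :=
  ∀ μ ∈ spectrum ℂ (toC S.A), μ.re < 0

/-- Discrete-time stability: all eigenvalues of `A` lie in the open unit disc. -/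
def IsSchur {σ ι o : Type} [Fintype σ] [DecidableEq σ] (S : StateSpace σ ι o) : Prop :=
  ∀ μ ∈ spectrum ℂ (toC S.A), ‖μ‖ < 1

/-- The step-invariant transformation with sampling period `τ`:
`A_d = e^{Aτ}`, `B_d = ∫₀^τ e^{At} B dt`, with `C` and `D` unchanged. -/
def c2d {n : ℕ} (S : SISO n) (τ : ℝ) : SISO n where
  A := NormedSpace.exp (τ • S.A)
  B := Matrix.of fun i j => ∫ t in (0 : ℝ)..τ, (NormedSpace.exp (t • S.A) * S.B) i j
  C := S.C
  D := S.D

/-- Discrete-time lifting of a single-input single-output discrete-time system by the factor `N`. -/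
def lift {n : ℕ} (S : SISO n) (N : ℕ) : StateSpace (Fin n) (Fin N) (Fin N) where
  A := S.A ^ N
  B := Matrix.of fun x j => (S.A ^ (N - 1 - (j : ℕ)) * S.B) x ()
  C := Matrix.of fun i x => (S.C * S.A ^ (i : ℕ)) () x
  D := Matrix.of fun i j =>
    if (j : ℕ) < (i : ℕ) then (S.C * S.A ^ ((i : ℕ) - (j : ℕ) - 1) * S.B) () ()
    else if j = i then S.D () () else 0

/-- The input-output map of a continuous-time system on signals on `[0, ∞)`
(continued by zero to negative times):
`(S w)(t) = D w(t) + ∫₀ᵗ C e^{A (t - τ)} B w(τ) dτ`. -/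
def contApply {n : ℕ} (S : SISO n) (w : ℝ → ℂ) (t : ℝ) : ℂ :=
  if 0 ≤ t then
    ((S.D () () : ℝ) : ℂ) * w t +
      ∫ τ in (0 : ℝ)..t, (((S.C * NormedSpace.exp ((t - τ) • S.A) * S.B) () () : ℝ) : ℂ) * w τ
  else 0

/-- The impulse response `D, C B, C A B, C A² B, …` of a discrete-time system. -/
def impulse {n : ℕ} (S : SISO n) : ℕ → ℝ
  | 0 => S.D () ()
  | k + 1 => (S.C * S.A ^ k * S.B) () ()

/-- The input-output map of a discrete-time system: convolution with its impulse response. -/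
def discApply {n : ℕ} (S : SISO n) (v : ℕ → ℂ) (k : ℕ) : ℂ :=
  ∑ i ∈ Finset.range (k + 1), ((S.impulse i : ℝ) : ℂ) * v (k - i)

end StateSpace

/-- A stable real-rational proper digital filter `K(z)`, of arbitrary order. -/
structure StableFilter where
  order : ℕ
  sys : SISO order
  stable : sys.IsSchur

/-- The ideal sampler with period `τ`. -/
def sampler (τ : ℝ) (u : ℝ → ℂ) (k : ℕ) : ℂ := u ((k : ℝ) * τ)

/-- The zero-order hold with period `τ`: the value is `ψ k` on `[kτ, (k+1)τ)`. -/
def hold (τ : ℝ) (ψ : ℕ → ℂ) (t : ℝ) : ℂ := if 0 ≤ t then ψ ⌊t / τ⌋₊ else 0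

/-- The upsampler `x₀, 0, …, 0, x₁, 0, …, 0, x₂, …` by the factor `L`. -/
def upsample (L : ℕ) (v : ℕ → ℂ) (k : ℕ) : ℂ := if L ∣ k then v (k / L) else 0

/-- The delay by `l`. -/
def delay (l : ℝ) (y : ℝ → ℂ) (t : ℝ) : ℂ := y (t - l)

/-- The multirate system: hold (period `h / L`), digital filter, upsampler, sampler (period `h`). -/
def multirateSystem (h : ℝ) (L : ℕ) (K : StableFilter) (u : ℝ → ℂ) : ℝ → ℂ :=
  hold (h / L) (K.sys.discApply (upsample L (sampler h u)))

/-- The multirate error system `(e^{-mhs} G - H_{h/L} K (↑L) S_h) F`. -/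
def errorSystem {nG nF : ℕ} (G : SISO nG) (F : SISO nF) (h : ℝ) (m L : ℕ) (K : StableFilter)
    (w : ℝ → ℂ) (t : ℝ) : ℂ :=
  delay ((m : ℝ) * h) (G.contApply (F.contApply w)) t - multirateSystem h L K (F.contApply w) t

/-- Continuous-time lifting: the `k`-th entry is the piece of the signal on `[kh, (k+1)h)`. -/
def contLift (h : ℝ) (y : ℝ → ℂ) (k : ℕ) (θ : ℝ) : ℂ := y ((k : ℝ) * h + θ)

/-- Inverse of continuous-time lifting. -/
def contUnlift (h : ℝ) (w : ℕ → ℝ → ℂ) (t : ℝ) : ℂ :=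
  if 0 ≤ t then w ⌊t / h⌋₊ (t - (⌊t / h⌋₊ : ℝ) * h) else 0

/-- The lifted system, acting on sequences of functions on `[0, h)`. -/
def liftedSystem (h : ℝ) (E : (ℝ → ℂ) → ℝ → ℂ) (w : ℕ → ℝ → ℂ) : ℕ → ℝ → ℂ :=
  contLift h (E (contUnlift h w))

/-- The Hilbert space `L²[0, h)` (complex valued). -/
abbrev L2 (h : ℝ) := Lp ℂ 2 (volume.restrict (Set.Ico (0 : ℝ) h))

/-- `T` is the value at `z` of the transfer function `∑ₖ z⁻ᵏ Êₖ` of the lifted system of the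
`h`-periodic system `E`. The bounded operator `Êₖ` on `L²[0, h)` is the `k`-th entry of the impulse
response of the lifted system: it maps `w` to the `k`-th entry of the response to `w, 0, 0, …`.
The series converges in operator norm, and `T` is uniquely determined. -/
def IsLiftedTransfer (h : ℝ) (E : (ℝ → ℂ) → ℝ → ℂ) (z : ℂ) (T : L2 h →L[ℂ] L2 h) : Prop :=
  ∃ Ehat : ℕ → (L2 h →L[ℂ] L2 h),
    (∀ (k : ℕ) (w : L2 h),
      (Ehat k w : ℝ → ℂ) =ᵐ[volume.restrict (Set.Ico (0 : ℝ) h)]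
        liftedSystem h E (Pi.single 0 (w : ℝ → ℂ)) k) ∧
    HasSum (fun k : ℕ => (z ^ k)⁻¹ • Ehat k) T

/-- The row `S_N = [1, 0, …, 0]`. -/
def SN (N : ℕ) : Matrix Unit (Fin N) ℂ := Matrix.of fun _ j => if (j : ℕ) = 0 then 1 else 0

/-- The block diagonal matrix with `L` diagonal blocks, each a column of `p` ones. -/
def HtildeN (L p : ℕ) : Matrix (Fin (L * p)) (Fin L) ℂ :=
  Matrix.of fun i j => if (i : ℕ) / p = (j : ℕ) then 1 else 0

/-- `K̃(z) = lift(K(z), L) [1, 0, …, 0]ᵀ`. -/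
def Ktilde (L : ℕ) (K : StableFilter) (z : ℂ) : Matrix (Fin L) Unit ℂ :=
  (K.sys.lift L).transfer z * (SN L).transpose

/-- The fast sample/hold approximation `E_{mr,N}(z) = (z⁻ᵐ G_N(z) - H̃_N K̃(z) S_N) F_N(z)`, with
`N = L p`. Here `z` belongs to the period `h`, so the delay `m h`, which is `m N` steps of the fast
period `h / N`, is `z⁻ᵐ` after lifting. -/
def approxError {nG nF : ℕ} (G : SISO nG) (F : SISO nF) (h : ℝ) (m L p : ℕ) (K : StableFilter)
    (z : ℂ) : Matrix (Fin (L * p)) (Fin (L * p)) ℂ :=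
  ((z ^ m)⁻¹ • ((G.c2d (h / ((L * p : ℕ) : ℝ))).lift (L * p)).transfer z -
      HtildeN L p * Ktilde L K z * SN (L * p)) *
    ((F.c2d (h / ((L * p : ℕ) : ℝ))).lift (L * p)).transfer z

/-- The norm of a matrix as an operator on Euclidean space (its largest singular value). -/
def specNorm {N : ℕ} (M : Matrix (Fin N) (Fin N) ℂ) : ℝ :=
  ‖Matrix.toEuclideanCLM (n := Fin N) (𝕜 := ℂ) M‖

/-- The point `e^{jωh}` of the unit circle. -/
def freqPoint (h ω : ℝ) : ℂ := Complex.exp (((ω * h : ℝ) : ℂ) * Complex.I)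

/-- The filters `K̃`, `K ∈ 𝒦`, form a compact set for the `H^∞` norm, that is, for uniform
convergence of the transfer functions on the unit circle. -/
def IsCompactFilterSet (L : ℕ) (𝒦 : Set StableFilter) : Prop :=
  IsCompact ((fun K : StableFilter =>
    UniformFun.ofFun (fun z : Circle => fun i : Fin L => Ktilde L K (z : ℂ) i ())) '' 𝒦)

end Multirate

end

/-!
For `|z| = 1` every system in the statement is described by its impulse response, a sequence
`aₖ` of operators on `L²[0, h)` with summable norms, and its transfer function is `∑ₖ z⁻ᵏ aₖ`.
For a strictly proper continuous-time system with impulse response `f(t) = C e^{At} B` the operator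
`aₖ` is the integral operator with kernel `f(kh + θ - τ)`, where `f` is zero at negative times
(`pieceOp`). The direct term of `G` is a multiple of the identity. Sampling once in each period
freezes `θ` at `0` (`sampleOp`), and the hold after the filter multiplies by the polyphase components
of the impulse response of `K` on the blocks of length `h / L` (`filterOp`). Splitting the
convolution integrals and the filter sum into periods shows that the lifted impulse response of the
error system is built from these by Cauchy products (`errorOp_ae`), so that its transfer function is
the expected combination of products (`hasSum_errorTransfer`).

An `N × N` matrix acts on step functions with `N` cells, which embed isometrically in `L²[0, h)`;
this realises it as an operator on `L²[0, h)` of the same norm, multiplicatively (`stepOp`,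
`norm_stepOp`, `stepOp_mul`). Step-invariant discretization is exact on step functions, hence the
impulse response of the fast-sampled system, divided by `h / N`, consists of mean values of `f`
over cells, and the realised matrix is an integral operator whose kernel is that of `aₖ` with values
of `f` replaced by such means. The two kernels differ by `O(1 / N)`, except on the diagonal cells,
where the kernel jumps but whose contribution to the `L²` norm of a row is `O(N^{-1/2})`. Since the
bounds and the Lipschitz constants of `f` on the windows `[(k-1)h, (k+1)h]` are summable
(`IsDecaying`), the errors add up to a bound that is independent of `z` (`norm_stepOp_sub_le`).

Combining the factors gives an error in operator norm that depends on the filter only through a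
bound for the entries of `K̃` on the unit circle (`abs_specNorm_sub_le`). A set of filters that is
compact in the `H^∞` norm has such a bound (`exists_norm_Ktilde_le`), and uniform convergence
follows.

Stability enters through the summability of the norms of the powers of the state matrix: Gelfand's
formula for the filter, and for `e^{Ah}` also the fact that every eigenvalue of `e^{Ah}` is the
exponential of an eigenvalue of `Ah`.
-/

noncomputable section

namespace Multirate

/-! ### Stability and powers of matrices -/

section Matrices

open scoped Matrix.Norms.Operator

variable {σ : Type} [Fintype σ] [DecidableEq σ]

theorem exp_mulVec_of_mulVec_eq_smul {A : Matrix σ σ ℂ} {v : σ → ℂ} {c : ℂ}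
    (hv : A.mulVec v = c • v) : (NormedSpace.exp A).mulVec v = Complex.exp c • v := by
  have hpow : ∀ n : ℕ, (A ^ n).mulVec v = c ^ n • v := by
    intro n
    induction n with
    | zero => simp
    | succ n ih => rw [pow_succ, ← Matrix.mulVec_mulVec, hv, Matrix.mulVec_smul, ih, smul_smul,
        pow_succ']
  have h1 := NormedSpace.exp_series_hasSum_exp' (𝕂 := ℂ) A
  have h2 : HasSum (fun n : ℕ => ((n.factorial : ℂ)⁻¹ • A ^ n).mulVec v)
      ((NormedSpace.exp A).mulVec v) :=
    h1.map (Matrix.mulVec.addMonoidHomLeft v) (by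
      show Continuous fun M : Matrix σ σ ℂ => M.mulVec v
      fun_prop)
  have h3 := (NormedSpace.exp_series_hasSum_exp' (𝕂 := ℂ) c).smul_const v
  rw [← Complex.exp_eq_exp_ℂ] at h3
  refine h2.unique ?_
  convert h3 using 2 with n
  rw [Matrix.smul_mulVec, hpow, smul_assoc]

/-- The half of the spectral mapping theorem for the matrix exponential that stability needs.
An eigenspace of `exp A` is invariant under `A`, so it contains an eigenvector of `A`. -/
theorem exists_mem_spectrum_of_mem_spectrum_exp {A : Matrix σ σ ℂ} {c : ℂ}
    (hc : c ∈ spectrum ℂ (NormedSpace.exp A)) : ∃ a ∈ spectrum ℂ A, Complex.exp a = c := by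
  rw [← Matrix.spectrum_toLin', ← Module.End.hasEigenvalue_iff_mem_spectrum] at hc
  set f : Module.End ℂ (σ → ℂ) := Matrix.toLin' (NormedSpace.exp A) with hf
  set g : Module.End ℂ (σ → ℂ) := Matrix.toLin' A with hg
  have hcomm : Commute f g := by
    have : Commute (NormedSpace.exp A) A := (Commute.refl A).exp_left
    have h1 := congrArg Matrix.toLin' this.eq
    rwa [Matrix.toLin'_mul, Matrix.toLin'_mul] at h1
  have hmaps : Set.MapsTo g (f.eigenspace c) (f.eigenspace c) :=
    Module.End.mapsTo_genEigenspace_of_comm hcomm c 1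
  have : Nontrivial (f.eigenspace c) := by
    rw [Submodule.nontrivial_iff_ne_bot]; exact hc
  obtain ⟨a, ha⟩ := Module.End.exists_eigenvalue (g.restrict hmaps)
  obtain ⟨v, hv⟩ := ha.exists_hasEigenvector
  have hgv : A.mulVec (v : σ → ℂ) = a • (v : σ → ℂ) := by
    have := congrArg Subtype.val hv.apply_eq_smul
    exact this
  have hv0 : (v : σ → ℂ) ≠ 0 := by simpa using hv.2
  refine ⟨a, ?_, ?_⟩
  · rw [← Matrix.spectrum_toLin', ← Module.End.hasEigenvalue_iff_mem_spectrum]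
    refine Module.End.hasEigenvalue_of_hasEigenvector (x := (v : σ → ℂ)) ⟨?_, hv0⟩
    rw [Module.End.mem_eigenspace_iff]
    simpa using hgv
  · have h1 := exp_mulVec_of_mulVec_eq_smul hgv
    have h2 : (NormedSpace.exp A).mulVec (v : σ → ℂ) = c • (v : σ → ℂ) := by
      have := Module.End.mem_eigenspace_iff.1 v.2
      simpa [f] using this
    exact smul_left_injective ℂ hv0 (h1.symm.trans h2)

theorem summable_norm_pow_of_spectrum {A : Matrix σ σ ℂ}
    (hA : ∀ a ∈ spectrum ℂ A, ‖a‖ < 1) : Summable fun k : ℕ => ‖A ^ k‖ := by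
  rcases isEmpty_or_nonempty σ with hσ | hσ
  · have : ∀ k : ℕ, ‖A ^ k‖ = 0 := fun k => by
      rw [Subsingleton.elim (A ^ k) 0, norm_zero]
    simp [this]
  have hr : spectralRadius ℂ A < (1 : NNReal) :=
    spectrum.spectralRadius_lt_of_forall_lt A fun a ha => by
      rw [← NNReal.coe_lt_coe]; simpa using hA a ha
  obtain ⟨r, hr1, hr2⟩ := ENNReal.lt_iff_exists_nnreal_btwn.1 hr
  have hlim := spectrum.pow_nnnorm_pow_one_div_tendsto_nhds_spectralRadius A
  have hev := (hlim.eventually (gt_mem_nhds hr1)).and (eventually_gt_atTop 0)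
  have hr' : (r : ℝ) < 1 := by exact_mod_cast hr2
  refine summable_of_isBigO_nat (summable_geometric_of_lt_one r.2 hr')
    (Asymptotics.IsBigO.of_bound 1 ?_)
  filter_upwards [hev] with n hn
  obtain ⟨h1, h0⟩ := hn
  have h2 : (‖A ^ n‖₊ : ENNReal) ≤ (r : ENNReal) ^ n := by
    have h3 := ENNReal.rpow_le_rpow h1.le (Nat.cast_nonneg (α := ℝ) n)
    rwa [← ENNReal.rpow_mul, one_div_mul_cancel (by positivity), ENNReal.rpow_one,
      ENNReal.rpow_natCast] at h3
  have h4 : ‖A ^ n‖₊ ≤ r ^ n := by exact_mod_cast h2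
  have h5 : ‖A ^ n‖ ≤ (r : ℝ) ^ n := by exact_mod_cast h4
  simpa using h5

theorem norm_toC {α β : Type} [Fintype α] [Fintype β] (M : Matrix α β ℝ) : ‖toC M‖ = ‖M‖ := by
  simp [Matrix.linfty_opNorm_def, toC]

theorem toC_mul {α β γ : Type} [Fintype β] (M : Matrix α β ℝ) (N : Matrix β γ ℝ) :
    toC (M * N) = toC M * toC N := by
  ext i j
  simp [toC, Matrix.mul_apply]

theorem toC_pow (M : Matrix σ σ ℝ) (k : ℕ) : toC (M ^ k) = toC M ^ k := by
  have : ∀ N : Matrix σ σ ℝ, toC N = Complex.ofRealHom.mapMatrix N := fun N => rfl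
  simp only [this, map_pow]

theorem toC_exp (M : Matrix σ σ ℝ) : toC (NormedSpace.exp M) = NormedSpace.exp (toC M) := by
  have : ∀ N : Matrix σ σ ℝ, toC N = Complex.ofRealHom.mapMatrix N := fun N => rfl
  simp only [this]
  refine NormedSpace.map_exp (Complex.ofRealHom.mapMatrix : Matrix σ σ ℝ →+* Matrix σ σ ℂ) ?_ M
  show Continuous fun N : Matrix σ σ ℝ => N.map _
  exact continuous_id.matrix_map Complex.continuous_ofReal

theorem exp_add_smul (A : Matrix σ σ ℝ) (s t : ℝ) :
    NormedSpace.exp ((s + t) • A) = NormedSpace.exp (s • A) * NormedSpace.exp (t • A) := by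
  rw [add_smul]
  exact Matrix.exp_add_of_commute _ _ (((Commute.refl A).smul_left s).smul_right t)

theorem exp_natCast_mul_smul (A : Matrix σ σ ℝ) (k : ℕ) (s : ℝ) :
    NormedSpace.exp (((k : ℝ) * s) • A) = NormedSpace.exp (s • A) ^ k := by
  rw [mul_smul, Nat.cast_smul_eq_nsmul, Matrix.exp_nsmul]

/-- The powers of the state matrix of a stable discrete-time system are summable. -/
theorem StateSpace.IsSchur.summable_norm_pow {ι o : Type} {S : StateSpace σ ι o}
    (hS : S.IsSchur) : Summable fun k : ℕ => ‖S.A ^ k‖ := by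
  have := summable_norm_pow_of_spectrum hS
  simpa [← toC_pow, norm_toC] using this

/-- Sampling a stable continuous-time system gives a state matrix with summable powers. -/
theorem StateSpace.IsHurwitz.summable_norm_exp_pow {ι o : Type} {S : StateSpace σ ι o}
    (hS : S.IsHurwitz) {h : ℝ} (hh : 0 < h) :
    Summable fun k : ℕ => ‖NormedSpace.exp (h • S.A) ^ k‖ := by
  have key : Summable fun k : ℕ => ‖NormedSpace.exp (toC (h • S.A)) ^ k‖ := by
    refine summable_norm_pow_of_spectrum fun a ha => ?_
    obtain ⟨b, hb, rfl⟩ := exists_mem_spectrum_of_mem_spectrum_exp ha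
    have hsm : toC (h • S.A) = (h : ℂ) • toC S.A := by ext i j; simp [toC]
    have hu : IsUnit (h : ℂ) := by simpa using hh.ne'
    rw [hsm, ← hu.unit_spec, ← Units.smul_def, spectrum.unit_smul_eq_smul] at hb
    obtain ⟨d, hd, rfl⟩ := hb
    have := hS d hd
    rw [Complex.norm_exp, Real.exp_lt_one_iff]
    simpa [Units.smul_def] using mul_neg_of_pos_of_neg hh this
  simpa [← toC_exp, ← toC_pow, norm_toC] using key

/-- The Neumann series of the resolvent on the unit circle, for a matrix whose powers are summable
(its norm need not be less than one). -/
theorem hasSum_resolvent {A : Matrix σ σ ℂ} (hA : Summable fun k : ℕ => ‖A ^ k‖) {z : ℂ}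
    (hz : ‖z‖ = 1) :
    HasSum (fun k : ℕ => (z ^ (k + 1))⁻¹ • A ^ k) ((z • (1 : Matrix σ σ ℂ) - A)⁻¹) := by
  have hz0 : z ≠ 0 := by rintro rfl; simp at hz
  have hs : Summable fun k : ℕ => (z ^ (k + 1))⁻¹ • A ^ k :=
    Summable.of_norm (by simpa [norm_smul, hz] using hA)
  have h1 : (z • (1 : Matrix σ σ ℂ) - A) * ∑' k : ℕ, (z ^ (k + 1))⁻¹ • A ^ k = 1 := by
    have e1 : (z • (1 : Matrix σ σ ℂ)) * ∑' k : ℕ, (z ^ (k + 1))⁻¹ • A ^ k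
        = 1 + ∑' k : ℕ, (z ^ (k + 1))⁻¹ • A ^ (k + 1) := by
      rw [hs.tsum_eq_zero_add, mul_add]
      congr 1
      · simp [smul_smul, hz0]
      · rw [← ((summable_nat_add_iff 1).2 hs).tsum_mul_left]
        refine tsum_congr fun k => ?_
        rw [Matrix.smul_mul, one_mul, smul_smul]
        congr 1
        field_simp
        ring
    rw [sub_mul, e1, ← hs.tsum_mul_left]
    simp [← pow_succ']
  rw [Matrix.inv_eq_right_inv h1]
  exact hs.hasSum

end Matrices

/-! ### Impulse responses of sampled and lifted systems -/

section ImpulseResponses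

open scoped Matrix.Norms.Operator

/-- The entry of index `(i, j)` of the infinite lower triangular Toeplitz matrix with first
column `η`. -/
def toeplitz (η : ℕ → ℝ) (i j : ℕ) : ℂ := if j ≤ i then (η (i - j) : ℂ) else 0

/-- The map `M ↦ C M B` for a row `C` and a column `B`. -/
def sandwich {n : ℕ} (C : Matrix Unit (Fin n) ℝ) (B : Matrix (Fin n) Unit ℝ) :
    Matrix (Fin n) (Fin n) ℝ →L[ℝ] ℝ :=
  LinearMap.toContinuousLinearMap
    { toFun := fun M => (C * M * B) () ()
      map_add' := fun M N => by simp [Matrix.mul_add, Matrix.add_mul]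
      map_smul' := fun r M => by simp }

theorem sandwich_apply {n : ℕ} (C : Matrix Unit (Fin n) ℝ) (B : Matrix (Fin n) Unit ℝ)
    (M : Matrix (Fin n) (Fin n) ℝ) : sandwich C B M = (C * M * B) () () := rfl

theorem abs_sandwich_le {n : ℕ} (C : Matrix Unit (Fin n) ℝ) (B : Matrix (Fin n) Unit ℝ)
    (M : Matrix (Fin n) (Fin n) ℝ) : |sandwich C B M| ≤ ‖C‖ * ‖M‖ * ‖B‖ := by
  have h1 : |(C * M * B) () ()| = ‖C * M * B‖ := by
    simp [Matrix.linfty_opNorm_def]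
  rw [sandwich_apply, h1]
  refine (Matrix.linfty_opNorm_mul _ _).trans ?_
  gcongr
  exact Matrix.linfty_opNorm_mul _ _

namespace StateSpace

/-- The entries of a lifted system are the series in `z⁻¹` of the Toeplitz matrix of the impulse
response, read in blocks of length `N`. -/
theorem hasSum_lift_transfer {n : ℕ} (S : SISO n) {N : ℕ}
    (hA : Summable fun k : ℕ => ‖(S.A ^ N) ^ k‖) {z : ℂ} (hz : ‖z‖ = 1) (i j : Fin N) :
    HasSum (fun k : ℕ => (z ^ k)⁻¹ * toeplitz S.impulse (k * N + i) j)
      ((S.lift N).transfer z i j) := by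
  have hA' : Summable fun k : ℕ => ‖toC (S.A ^ N) ^ k‖ := by
    simpa [← toC_pow, norm_toC] using hA
  have h1 := hasSum_resolvent hA' hz
  have h2 : HasSum (fun k : ℕ =>
      (toC (S.lift N).C * ((z ^ (k + 1))⁻¹ • toC (S.A ^ N) ^ k) * toC (S.lift N).B) i j)
      ((toC (S.lift N).C * (z • (1 : Matrix (Fin n) (Fin n) ℂ) - toC (S.A ^ N))⁻¹ *
        toC (S.lift N).B) i j) := by
    let φ : Matrix (Fin n) (Fin n) ℂ →+ ℂ :=
      { toFun := fun M => (toC (S.lift N).C * M * toC (S.lift N).B) i j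
        map_zero' := by simp
        map_add' := fun M M' => by simp [Matrix.mul_add, Matrix.add_mul] }
    have hφ : Continuous φ := by
      show Continuous fun M : Matrix (Fin n) (Fin n) ℂ => (toC (S.lift N).C * M * toC (S.lift N).B) i j
      exact ((continuous_const.matrix_mul continuous_id).matrix_mul continuous_const).matrix_elem
        i j
    exact h1.map φ hφ
  rw [← hasSum_nat_add_iff' 1]
  have hD : ((S.lift N).D i j : ℂ) = toeplitz S.impulse i j := by
    simp only [StateSpace.lift, toeplitz, Matrix.of_apply]
    rcases lt_trichotomy (j : ℕ) i with h | h | h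
    · rw [if_pos h, if_pos h.le]
      obtain ⟨d, hd⟩ := Nat.exists_eq_add_of_lt h
      rw [show (i : ℕ) - j = d + 1 by omega]
      simp [impulse]
    · have : j = i := Fin.ext h
      simp [this, impulse]
    · have h' : ¬ j = i := fun e => by rw [e] at h; exact lt_irrefl _ h
      simp [h.not_gt, h.not_ge, h']
  have e3 : (S.lift N).transfer z i j -
      ∑ k ∈ Finset.range 1, (z ^ k)⁻¹ * toeplitz S.impulse (k * N + i) j
      = (toC (S.lift N).C * (z • (1 : Matrix (Fin n) (Fin n) ℂ) - toC (S.A ^ N))⁻¹ *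
        toC (S.lift N).B) i j := by
    simp only [Finset.range_one, Finset.sum_singleton, pow_zero, inv_one, one_mul, zero_mul,
      zero_add, ← hD]
    simp [transfer, toC, StateSpace.lift]
  rw [e3]
  refine h2.congr_fun fun k => ?_
  have e1 : (toC (S.lift N).C * ((z ^ (k + 1))⁻¹ • toC (S.A ^ N) ^ k) * toC (S.lift N).B) i j
      = (z ^ (k + 1))⁻¹ * (((S.lift N).C * (S.A ^ N) ^ k * (S.lift N).B) i j : ℝ) := by
    rw [Matrix.mul_smul, Matrix.smul_mul, ← toC_pow, ← toC_mul, ← toC_mul]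
    simp [toC]
  rw [e1]
  congr 1
  have hj := j.2
  have hle : (j : ℕ) ≤ (k + 1) * N + i := by nlinarith [i.2]
  have hidx : (k + 1) * N + i - j = (i + N * k + (N - 1 - j)) + 1 := by
    have : (k + 1) * N = N * k + N := by ring
    omega
  rw [toeplitz, if_pos hle, hidx, impulse]
  congr 1
  have e2 : ((S.lift N).C * (S.A ^ N) ^ k * (S.lift N).B) i j
      = ((S.C * S.A ^ (i : ℕ)) * (S.A ^ N) ^ k * (S.A ^ (N - 1 - (j : ℕ)) * S.B)) () () := by
    simp only [Matrix.mul_apply, StateSpace.lift, Matrix.of_apply]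
  rw [e2, pow_add, pow_add, pow_mul]
  simp only [Matrix.mul_assoc]

/-- The impulse response `C e^{At} B` of a continuous-time system, without the direct
term `D`. -/
def contImpulse {n : ℕ} (S : SISO n) (t : ℝ) : ℝ := sandwich S.C S.B (NormedSpace.exp (t • S.A))

theorem hasDerivAt_contImpulse {n : ℕ} (S : SISO n) (t : ℝ) :
    HasDerivAt S.contImpulse (sandwich S.C S.B (NormedSpace.exp (t • S.A) * S.A)) t :=
  (sandwich S.C S.B).hasFDerivAt.comp_hasDerivAt t (hasDerivAt_exp_smul_const S.A t)

theorem continuous_contImpulse {n : ℕ} (S : SISO n) : Continuous S.contImpulse :=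
  continuous_iff_continuousAt.2 fun t => (S.hasDerivAt_contImpulse t).continuousAt

/-- The step-invariant transformation is exact on held inputs: its impulse response consists of
the integrals of the continuous-time impulse response over the sampling intervals. -/
theorem impulse_c2d_succ {n : ℕ} (S : SISO n) (δ : ℝ) (k : ℕ) :
    (S.c2d δ).impulse (k + 1) = ∫ t in ((k : ℝ) * δ)..((k + 1 : ℝ) * δ), S.contImpulse t := by
  have hexp : Continuous fun t : ℝ => NormedSpace.exp (t • S.A) :=
    continuous_iff_continuousAt.2 fun t => (hasDerivAt_exp_smul_const S.A t).continuousAt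
  have e1 : ∫ t in ((k : ℝ) * δ)..((k + 1 : ℝ) * δ), S.contImpulse t
      = ∫ t in (0 : ℝ)..δ, S.contImpulse ((k : ℝ) * δ + t) := by
    rw [intervalIntegral.integral_comp_add_left (fun t => S.contImpulse t)]
    congr 1 <;> ring
  have e2 : ∀ t, S.contImpulse ((k : ℝ) * δ + t)
      = ∑ x, (S.C * NormedSpace.exp (δ • S.A) ^ k) () x *
          (NormedSpace.exp (t • S.A) * S.B) x () := fun t => by
    rw [contImpulse, sandwich_apply, exp_add_smul, exp_natCast_mul_smul, ← Matrix.mul_apply]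
    simp only [Matrix.mul_assoc]
  rw [e1]
  simp only [e2]
  rw [intervalIntegral.integral_finsetSum]
  · simp only [intervalIntegral.integral_const_mul]
    simp only [impulse, c2d]
    rw [Matrix.mul_apply]
    simp only [Matrix.of_apply]
  · intro x _
    refine (Continuous.intervalIntegrable ?_ _ _)
    exact continuous_const.mul ((hexp.matrix_mul continuous_const).matrix_elem x ())

end StateSpace

/-- The `k`-th window `[(k-1)h, (k+1)h]` (`[0, h]` for `k = 0`, by truncated subtraction). It
contains all nonnegative differences `kh + θ - τ` with `θ, τ ∈ [0, h)`. -/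
def window (h : ℝ) (k : ℕ) : Set ℝ := Set.Icc (((k - 1 : ℕ) : ℝ) * h) (((k : ℝ) + 1) * h)

/-- A continuous function whose bounds and Lipschitz constants on the windows of length `2h` are
summable. -/
structure IsDecaying (f : ℝ → ℝ) (h : ℝ) (c : ℕ → ℝ) : Prop where
  continuous : Continuous f
  summable : Summable c
  bound : ∀ k, ∀ t ∈ window h k, |f t| ≤ c k
  lipschitz : ∀ k, ∀ s ∈ window h k, ∀ t ∈ window h k, |f s - f t| ≤ c k * |s - t|

theorem StateSpace.IsHurwitz.exists_isDecaying {n : ℕ} {S : SISO n} (hS : S.IsHurwitz) {h : ℝ}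
    (hh : 0 < h) : ∃ c, IsDecaying S.contImpulse h c := by
  have hexp : Continuous fun t : ℝ => NormedSpace.exp (t • S.A) :=
    continuous_iff_continuousAt.2 fun t => (hasDerivAt_exp_smul_const S.A t).continuousAt
  obtain ⟨E, hE⟩ := (isCompact_Icc (a := (0 : ℝ)) (b := 2 * h)).exists_bound_of_continuousOn
    hexp.continuousOn
  have hE0 : 0 ≤ E := (norm_nonneg _).trans (hE 0 ⟨le_rfl, by positivity⟩)
  set a : ℕ → ℝ := fun k => ‖NormedSpace.exp (h • S.A) ^ (k - 1)‖ with ha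
  have hsum : Summable a := by
    rw [← summable_nat_add_iff 1]
    simpa [ha] using hS.summable_norm_exp_pow hh
  have hexpb : ∀ k, ∀ t ∈ window h k, ‖NormedSpace.exp (t • S.A)‖ ≤ a k * E := by
    intro k t ht
    have e : t = ((k - 1 : ℕ) : ℝ) * h + (t - ((k - 1 : ℕ) : ℝ) * h) := by ring
    rw [e, exp_add_smul, exp_natCast_mul_smul]
    refine (norm_mul_le _ _).trans ?_
    gcongr
    refine hE _ ⟨by linarith [ht.1], ?_⟩
    have h1 := ht.2
    have h2 : (k : ℝ) ≤ ((k - 1 : ℕ) : ℝ) + 1 := by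
      have : k ≤ (k - 1) + 1 := by omega
      exact_mod_cast this
    nlinarith
  set c0 : ℝ := ‖S.C‖ * E * ‖S.B‖ + ‖S.C‖ * (E * ‖S.A‖) * ‖S.B‖ with hc0
  have hp1 : 0 ≤ ‖S.C‖ * E * ‖S.B‖ := by positivity
  have hp2 : 0 ≤ ‖S.C‖ * (E * ‖S.A‖) * ‖S.B‖ := by positivity
  refine ⟨fun k => a k * c0, S.continuous_contImpulse, hsum.mul_right _, ?_, ?_⟩
  · intro k t ht
    refine (abs_sandwich_le _ _ _).trans ?_
    have h1 := hexpb k t ht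
    calc ‖S.C‖ * ‖NormedSpace.exp (t • S.A)‖ * ‖S.B‖ ≤ ‖S.C‖ * (a k * E) * ‖S.B‖ := by gcongr
      _ = a k * (‖S.C‖ * E * ‖S.B‖) := by ring
      _ ≤ a k * c0 := by
        refine mul_le_mul_of_nonneg_left ?_ (norm_nonneg _)
        linarith
  · intro k s hs t ht
    have hconv := convex_Icc (𝕜 := ℝ) (((k - 1 : ℕ) : ℝ) * h) (((k : ℝ) + 1) * h)
    have := hconv.norm_image_sub_le_of_norm_hasDerivWithin_le
      (C := a k * c0) (fun x _ => (S.hasDerivAt_contImpulse x).hasDerivWithinAt) (fun x hx => ?_)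
      ht hs
    · simpa using this
    · have h1 := hexpb k x hx
      refine (abs_sandwich_le _ _ _).trans ?_
      calc ‖S.C‖ * ‖NormedSpace.exp (x • S.A) * S.A‖ * ‖S.B‖
          ≤ ‖S.C‖ * ((a k * E) * ‖S.A‖) * ‖S.B‖ := by
            gcongr
            exact (norm_mul_le _ _).trans (by gcongr)
        _ = a k * (‖S.C‖ * (E * ‖S.A‖) * ‖S.B‖) := by ring
        _ ≤ a k * c0 := by
          refine mul_le_mul_of_nonneg_left ?_ (norm_nonneg _)
          linarith

theorem StateSpace.IsSchur.summable_abs_impulse {n : ℕ} {S : SISO n} (hS : S.IsSchur) :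
    Summable fun k => |S.impulse k| := by
  rw [← summable_nat_add_iff 1]
  refine Summable.of_nonneg_of_le (fun _ => abs_nonneg _)
    (fun k => abs_sandwich_le S.C S.B (S.A ^ k)) ?_
  exact (hS.summable_norm_pow.mul_left _).mul_right _

end ImpulseResponses

/-! ### Integral operators on a period -/

section IntegralOperators

/-- `T` is the integral operator on `L²[0, h)` with kernel `k`. -/
def IsIntOp (h : ℝ) (k : ℝ → ℝ → ℂ) (T : L2 h →L[ℂ] L2 h) : Prop :=
  ∀ w : L2 h, (T w : ℝ → ℂ) =ᵐ[volume.restrict (Set.Ico (0 : ℝ) h)]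
    fun θ => ∫ τ in Set.Ico (0 : ℝ) h, k θ τ * w τ

/-- Measurable kernels that are bounded on `[0, h)²`. -/
structure IsBddKernel (h : ℝ) (k : ℝ → ℝ → ℂ) : Prop where
  measurable : Measurable (Function.uncurry k)
  bounded : ∃ M, ∀ θ ∈ Set.Ico (0 : ℝ) h, ∀ τ ∈ Set.Ico (0 : ℝ) h, ‖k θ τ‖ ≤ M

variable {h : ℝ}

theorem integrable_L2 (w : L2 h) : Integrable w (volume.restrict (Set.Ico (0 : ℝ) h)) :=
  (Lp.memLp w).integrable one_le_two

theorem integrable_mul_L2 {g : ℝ → ℂ} (hg : Measurable g) {M : ℝ}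
    (hM : ∀ τ ∈ Set.Ico (0 : ℝ) h, ‖g τ‖ ≤ M) (w : L2 h) :
    Integrable (fun τ => g τ * w τ) (volume.restrict (Set.Ico (0 : ℝ) h)) := by
  refine (integrable_L2 w).bdd_mul hg.aestronglyMeasurable (c := M) ?_
  filter_upwards [ae_restrict_mem measurableSet_Ico] with τ hτ using hM τ hτ

theorem norm_integral_mul_L2_le {g : ℝ → ℂ} (hg : Measurable g) {M : ℝ}
    (hM : ∀ τ ∈ Set.Ico (0 : ℝ) h, ‖g τ‖ ≤ M) {c : ℝ} (hc : 0 ≤ c)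
    (hgc : ∫ τ in Set.Ico (0 : ℝ) h, ‖g τ‖ ^ 2 ≤ c ^ 2) (w : L2 h) :
    ‖∫ τ in Set.Ico (0 : ℝ) h, g τ * w τ‖ ≤ c * ‖w‖ := by
  have hmem : MemLp (fun τ => (starRingEnd ℂ) (g τ)) 2
      (volume.restrict (Set.Ico (0 : ℝ) h)) := by
    refine MemLp.of_bound ?_ M ?_
    · exact (Complex.continuous_conj.measurable.comp hg).aestronglyMeasurable
    · filter_upwards [ae_restrict_mem measurableSet_Ico] with τ hτ
      simpa using hM τ hτ
  have h1 : inner ℂ (hmem.toLp _) w = ∫ τ in Set.Ico (0 : ℝ) h, g τ * w τ := by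
    rw [L2.inner_def]
    refine integral_congr_ae ?_
    filter_upwards [hmem.coeFn_toLp] with τ hτ
    rw [hτ, RCLike.inner_apply]
    simp [mul_comm]
  have h2 : ‖hmem.toLp _‖ ≤ c := by
    refine le_of_sq_le_sq ?_ hc
    refine le_trans (le_of_eq ?_) hgc
    rw [← inner_self_eq_norm_sq (𝕜 := ℂ), L2.inner_def, ← integral_re]
    · refine integral_congr_ae ?_
      filter_upwards [hmem.coeFn_toLp] with τ hτ
      rw [hτ, inner_self_eq_norm_sq (𝕜 := ℂ)]
      simp
    · exact L2.integrable_inner _ _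
  rw [← h1]
  exact (norm_inner_le_norm _ _).trans (by gcongr)

namespace IsBddKernel

variable {k k' : ℝ → ℝ → ℂ}

theorem measurable_row (hk : IsBddKernel h k) (θ : ℝ) : Measurable (k θ) :=
  hk.measurable.comp measurable_prodMk_left

theorem integrable_row (hk : IsBddKernel h k) {θ : ℝ} (hθ : θ ∈ Set.Ico (0 : ℝ) h) (w : L2 h) :
    Integrable (fun τ => k θ τ * w τ) (volume.restrict (Set.Ico (0 : ℝ) h)) := by
  obtain ⟨M, hM⟩ := hk.bounded
  exact integrable_mul_L2 (hk.measurable_row θ) (hM θ hθ) w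

theorem sub (hk : IsBddKernel h k) (hk' : IsBddKernel h k') :
    IsBddKernel h (fun θ τ => k θ τ - k' θ τ) := by
  obtain ⟨M, hM⟩ := hk.bounded
  obtain ⟨M', hM'⟩ := hk'.bounded
  exact ⟨hk.measurable.sub hk'.measurable, M + M', fun θ hθ τ hτ =>
    (norm_sub_le _ _).trans (add_le_add (hM θ hθ τ hτ) (hM' θ hθ τ hτ))⟩

theorem stronglyMeasurable_integral (hk : IsBddKernel h k) (w : L2 h) :
    StronglyMeasurable fun θ => ∫ τ in Set.Ico (0 : ℝ) h, k θ τ * w τ := by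
  refine StronglyMeasurable.integral_prod_right (f := fun θ τ => k θ τ * w τ) ?_
  exact hk.measurable.stronglyMeasurable.mul
    ((Lp.stronglyMeasurable w).comp_measurable measurable_snd)

theorem exists_integral_bound (hk : IsBddKernel h k) (w : L2 h) :
    ∃ c, ∀ θ ∈ Set.Ico (0 : ℝ) h, ‖∫ τ in Set.Ico (0 : ℝ) h, k θ τ * w τ‖ ≤ c := by
  obtain ⟨M, hM⟩ := hk.bounded
  refine ⟨∫ τ in Set.Ico (0 : ℝ) h, M * ‖w τ‖, fun θ hθ => ?_⟩
  refine norm_integral_le_of_norm_le ((integrable_L2 w).norm.const_mul M) ?_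
  filter_upwards [ae_restrict_mem measurableSet_Ico] with τ hτ
  rw [norm_mul]
  exact mul_le_mul_of_nonneg_right (hM θ hθ τ hτ) (norm_nonneg _)

theorem memLp_integral (hk : IsBddKernel h k) (w : L2 h) :
    MemLp (fun θ => ∫ τ in Set.Ico (0 : ℝ) h, k θ τ * w τ) 2
      (volume.restrict (Set.Ico (0 : ℝ) h)) := by
  obtain ⟨c, hc⟩ := hk.exists_integral_bound w
  refine MemLp.of_bound (hk.stronglyMeasurable_integral w).aestronglyMeasurable c ?_
  filter_upwards [ae_restrict_mem measurableSet_Ico] with θ hθ using hc θ hθ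

end IsBddKernel

theorem norm_L2_le_of_ae_bound (hh : 0 ≤ h) {u : L2 h} {c : ℝ} (hc : 0 ≤ c)
    (hu : ∀ᵐ θ ∂volume.restrict (Set.Ico (0 : ℝ) h), ‖u θ‖ ≤ c) : ‖u‖ ≤ Real.sqrt h * c := by
  have h1 := Lp.norm_le_of_ae_bound (p := 2) hc hu
  have h2 : (measureUnivNNReal (volume.restrict (Set.Ico (0 : ℝ) h)) : ℝ) = h := by
    simp only [measureUnivNNReal, Measure.restrict_apply_univ, Real.volume_Ico, sub_zero]
    exact ENNReal.toReal_ofReal hh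
  rw [Real.sqrt_eq_rpow]
  simpa [NNReal.coe_rpow, h2] using h1

/-- A kernel whose rows have `L²` norm at most `c` gives an operator of norm at most `√h c`. -/
theorem IsIntOp.norm_le (hh : 0 ≤ h) {k : ℝ → ℝ → ℂ} {T : L2 h →L[ℂ] L2 h} (hT : IsIntOp h k T)
    (hk : IsBddKernel h k) {c : ℝ} (hc : 0 ≤ c)
    (hkc : ∀ θ ∈ Set.Ico (0 : ℝ) h, ∫ τ in Set.Ico (0 : ℝ) h, ‖k θ τ‖ ^ 2 ≤ c ^ 2) :
    ‖T‖ ≤ Real.sqrt h * c := by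
  obtain ⟨M, hM⟩ := hk.bounded
  refine T.opNorm_le_bound (by positivity) fun w => ?_
  rw [mul_assoc]
  refine norm_L2_le_of_ae_bound hh (by positivity) ?_
  filter_upwards [hT w, ae_restrict_mem measurableSet_Ico] with θ h1 hθ
  rw [h1]
  exact norm_integral_mul_L2_le (hk.measurable_row θ) (hM θ hθ) hc (hkc θ hθ) w

/-- A bounded measurable kernel defines a bounded operator on `L²[0, h)`. -/
theorem IsBddKernel.exists_isIntOp (hh : 0 ≤ h) {k : ℝ → ℝ → ℂ} (hk : IsBddKernel h k) :
    ∃ T, IsIntOp h k T := by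
  obtain ⟨M, hM⟩ := hk.bounded
  let T₀ : L2 h →ₗ[ℂ] L2 h :=
    { toFun := fun w => (hk.memLp_integral w).toLp _
      map_add' := fun w w' => by
        rw [← MemLp.toLp_add]
        refine MemLp.toLp_congr _ _ ?_
        filter_upwards [ae_restrict_mem measurableSet_Ico] with θ hθ
        rw [Pi.add_apply, ← integral_add (hk.integrable_row hθ w) (hk.integrable_row hθ w')]
        refine integral_congr_ae ?_
        filter_upwards [Lp.coeFn_add w w'] with τ hτ
        rw [hτ, Pi.add_apply, mul_add]
      map_smul' := fun c w => by
        rw [RingHom.id_apply, ← MemLp.toLp_const_smul]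
        refine MemLp.toLp_congr _ _ ?_
        filter_upwards with θ
        rw [Pi.smul_apply, ← integral_smul]
        refine integral_congr_ae ?_
        filter_upwards [Lp.coeFn_smul c w] with τ hτ
        rw [hτ, Pi.smul_apply, smul_eq_mul, smul_eq_mul]
        ring }
  have hT₀ : ∀ w : L2 h, (T₀ w : ℝ → ℂ) =ᵐ[volume.restrict (Set.Ico (0 : ℝ) h)]
      fun θ => ∫ τ in Set.Ico (0 : ℝ) h, k θ τ * w τ := fun w =>
    (hk.memLp_integral w).coeFn_toLp
  have hM' : 0 ≤ |M| * (h + 1) := by positivity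
  refine ⟨T₀.mkContinuous (Real.sqrt h * (|M| * (h + 1))) fun w => ?_, hT₀⟩
  rw [mul_assoc]
  refine norm_L2_le_of_ae_bound hh (by positivity) ?_
  filter_upwards [hT₀ w, ae_restrict_mem measurableSet_Ico] with θ h1 hθ
  rw [h1]
  refine norm_integral_mul_L2_le (hk.measurable_row θ) (hM θ hθ) hM' ?_ w
  calc ∫ τ in Set.Ico (0 : ℝ) h, ‖k θ τ‖ ^ 2 ≤ ∫ τ in Set.Ico (0 : ℝ) h, |M| ^ 2 := by
        refine integral_mono_of_nonneg (ae_of_all _ fun τ => by positivity)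
          (integrable_const _) ?_
        filter_upwards [ae_restrict_mem measurableSet_Ico] with τ hτ
        exact pow_le_pow_left₀ (norm_nonneg _) ((hM θ hθ τ hτ).trans (le_abs_self M)) 2
    _ = |M| ^ 2 * h := by simp [hh, mul_comm]
    _ ≤ (|M| * (h + 1)) ^ 2 := by
        rw [mul_pow]
        refine mul_le_mul_of_nonneg_left ?_ (by positivity)
        nlinarith

/-- The integral operator with kernel `k` (zero if `k` does not define a bounded operator). -/
def intOp (h : ℝ) (k : ℝ → ℝ → ℂ) : L2 h →L[ℂ] L2 h :=
  open Classical in if H : ∃ T, IsIntOp h k T then H.choose else 0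

theorem IsBddKernel.isIntOp (hh : 0 ≤ h) {k : ℝ → ℝ → ℂ} (hk : IsBddKernel h k) :
    IsIntOp h k (intOp h k) := by
  rw [intOp, dif_pos (hk.exists_isIntOp hh)]
  exact (hk.exists_isIntOp hh).choose_spec

theorem IsIntOp.sub {k k' : ℝ → ℝ → ℂ} {T T' : L2 h →L[ℂ] L2 h} (hT : IsIntOp h k T)
    (hT' : IsIntOp h k' T') (hk : IsBddKernel h k) (hk' : IsBddKernel h k') :
    IsIntOp h (fun θ τ => k θ τ - k' θ τ) (T - T') := by
  intro w
  filter_upwards [hT w, hT' w, Lp.coeFn_sub (T w) (T' w), ae_restrict_mem measurableSet_Ico]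
    with θ h1 h2 h3 hθ
  rw [sub_apply, h3, Pi.sub_apply, h1, h2,
    ← integral_sub (hk.integrable_row hθ w) (hk'.integrable_row hθ w)]
  simp only [sub_mul]

theorem IsIntOp.unique {k : ℝ → ℝ → ℂ} {T T' : L2 h →L[ℂ] L2 h} (hT : IsIntOp h k T)
    (hT' : IsIntOp h k T') : T = T' := by
  ext1 w
  exact Lp.ext ((hT w).trans (hT' w).symm)

theorem IsIntOp.congr {k k' : ℝ → ℝ → ℂ} {T : L2 h →L[ℂ] L2 h} (hT : IsIntOp h k T)
    (hkk' : ∀ θ ∈ Set.Ico (0 : ℝ) h, ∀ τ ∈ Set.Ico (0 : ℝ) h, k θ τ = k' θ τ) :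
    IsIntOp h k' T := by
  intro w
  filter_upwards [hT w, ae_restrict_mem measurableSet_Ico] with θ h1 hθ
  rw [h1]
  refine integral_congr_ae ?_
  filter_upwards [ae_restrict_mem measurableSet_Ico] with τ hτ
  rw [hkk' θ hθ τ hτ]

/-- A kernel `a(θ) b(τ)` factors through the mean value over `[0, h)`. -/
theorem IsIntOp.mul_rankOne (hh : 0 < h) {a b : ℝ → ℂ} {T T' : L2 h →L[ℂ] L2 h}
    (hT : IsIntOp h (fun θ _ => (h : ℂ)⁻¹ * a θ) T) (hT' : IsIntOp h (fun _ τ => b τ) T') :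
    IsIntOp h (fun θ τ => a θ * b τ) (T * T') := by
  intro w
  filter_upwards [hT (T' w)] with θ h1
  rw [mul_apply_eq_comp, h1, integral_const_mul, integral_congr_ae (hT' w)]
  have h0 : (h : ℂ) ≠ 0 := by exact_mod_cast hh.ne'
  simp only [mul_assoc, integral_const_mul]
  simp [hh.le]
  field_simp

end IntegralOperators

/-! ### Matrices as operators on step functions -/

section StepFunctions

variable {h : ℝ} {N : ℕ}

/-- The `i`-th cell of the partition of `[0, h)` into `N` cells of length `h / N`. -/
def cell (h : ℝ) (N i : ℕ) : Set ℝ := Set.Ico ((i : ℝ) * (h / N)) (((i : ℝ) + 1) * (h / N))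

theorem measurableSet_cell (h : ℝ) (N i : ℕ) : MeasurableSet (cell h N i) := measurableSet_Ico

theorem mem_cell_iff (hh : 0 < h) (hN : 0 < N) {i : ℕ} {θ : ℝ} (hθ : 0 ≤ θ) :
    θ ∈ cell h N i ↔ ⌊θ / (h / N)⌋₊ = i := by
  have hδ : 0 < h / (N : ℝ) := by positivity
  rw [Nat.floor_eq_iff (by positivity), cell, Set.mem_Ico, le_div_iff₀ hδ, div_lt_iff₀ hδ]

theorem floor_div_lt (hh : 0 < h) (hN : 0 < N) {θ : ℝ} (hθ : θ ∈ Set.Ico (0 : ℝ) h) :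
    ⌊θ / (h / N)⌋₊ < N := by
  have hδ : 0 < h / (N : ℝ) := by positivity
  have hN' : (0 : ℝ) < N := by exact_mod_cast hN
  rw [Nat.floor_lt (by have := hθ.1; positivity), div_lt_iff₀ hδ]
  have : (N : ℝ) * (h / N) = h := by field_simp
  rw [this]
  exact hθ.2

theorem cell_subset (hh : 0 < h) (i : Fin N) : cell h N i ⊆ Set.Ico 0 h := by
  have hN : (0 : ℝ) < N := by exact_mod_cast i.pos
  have hi : ((i : ℕ) : ℝ) + 1 ≤ N := by exact_mod_cast i.2
  intro θ hθ
  refine ⟨le_trans (by positivity) hθ.1, hθ.2.trans_le ?_⟩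
  calc (((i : ℕ) : ℝ) + 1) * (h / N) ≤ N * (h / N) := by gcongr
    _ = h := by field_simp

theorem measureReal_cell (hh : 0 < h) (i : Fin N) :
    (volume.restrict (Set.Ico (0 : ℝ) h)).real (cell h N i) = h / N := by
  rw [measureReal_restrict_apply (measurableSet_cell _ _ _),
    Set.inter_eq_self_of_subset_left (cell_subset hh i), cell, Real.volume_real_Ico_of_le]
  · ring
  · gcongr
    linarith

theorem disjoint_cell (hh : 0 < h) {i j : Fin N} (hij : i ≠ j) :
    Disjoint (cell h N i) (cell h N j) := by
  rw [Set.disjoint_left]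
  intro θ hi hj
  have h0 := (cell_subset hh i hi).1
  rw [mem_cell_iff hh i.pos h0] at hi hj
  exact hij (Fin.ext (hi.symm.trans hj))

/-- The normalised indicator functions of the cells. -/
def cellVec (h : ℝ) (N : ℕ) (i : Fin N) : L2 h :=
  indicatorConstLp 2 (measurableSet_cell h N i) (measure_ne_top _ _)
    (((Real.sqrt (h / N))⁻¹ : ℝ) : ℂ)

theorem orthonormal_cellVec (hh : 0 < h) : Orthonormal ℂ (cellVec h N) := by
  rw [orthonormal_iff_ite]
  intro i j
  rw [cellVec, cellVec, L2.inner_indicatorConstLp_indicatorConstLp]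
  split_ifs with hij
  · subst hij
    rw [Set.inter_self, measureReal_cell hh, RCLike.inner_apply, Complex.conj_ofReal,
      ← Complex.ofReal_mul, ← mul_inv, Real.mul_self_sqrt (by positivity)]
    have hN : (0 : ℝ) < N := by exact_mod_cast i.pos
    rw [Complex.real_smul, ← Complex.ofReal_mul, mul_inv_cancel₀ (by positivity),
      Complex.ofReal_one]
  · rw [(disjoint_cell hh hij).inter_eq]
    simp

/-- The embedding of `ℂᴺ` in `L²[0, h)` as step functions. -/
def stepEmb (h : ℝ) (N : ℕ) : EuclideanSpace ℂ (Fin N) →L[ℂ] L2 h :=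
  LinearMap.toContinuousLinearMap
    { toFun := fun v => ∑ i, v i • cellVec h N i
      map_add' := fun v w => by simp [add_smul, Finset.sum_add_distrib]
      map_smul' := fun c v => by simp [Finset.smul_sum, smul_smul] }

theorem stepEmb_apply (v : EuclideanSpace ℂ (Fin N)) :
    stepEmb h N v = ∑ i, v i • cellVec h N i := rfl

theorem adjoint_comp_stepEmb (hh : 0 < h) :
    (ContinuousLinearMap.adjoint (stepEmb h N)).comp (stepEmb h N) = 1 := by
  ext1 v
  refine ext_inner_left ℂ fun w => ?_
  rw [ContinuousLinearMap.comp_apply, ContinuousLinearMap.adjoint_inner_right, stepEmb_apply,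
    stepEmb_apply, (orthonormal_cellVec hh).inner_sum]
  simp [PiLp.inner_apply, mul_comm]

theorem norm_stepEmb_apply (hh : 0 < h) (v : EuclideanSpace ℂ (Fin N)) :
    ‖stepEmb h N v‖ = ‖v‖ :=
  (ContinuousLinearMap.norm_map_iff_adjoint_comp_self _).2 (adjoint_comp_stepEmb hh) v

/-- The operator on `L²[0, h)` that acts on step functions as the matrix `M`, and is zero on
their orthogonal complement. -/
def stepOp (h : ℝ) {N : ℕ} (M : Matrix (Fin N) (Fin N) ℂ) : L2 h →L[ℂ] L2 h :=
  (stepEmb h N).comp ((Matrix.toEuclideanCLM (n := Fin N) (𝕜 := ℂ) M).comp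
    (ContinuousLinearMap.adjoint (stepEmb h N)))

theorem norm_stepOp (hh : 0 < h) (M : Matrix (Fin N) (Fin N) ℂ) : ‖stepOp h M‖ = specNorm M := by
  have hJ : ‖stepEmb h N‖ ≤ 1 := ContinuousLinearMap.opNorm_le_bound _ zero_le_one fun v => by
    rw [norm_stepEmb_apply hh, one_mul]
  have hJ' : ‖ContinuousLinearMap.adjoint (stepEmb h N)‖ ≤ 1 := by
    rwa [LinearIsometryEquiv.norm_map]
  apply le_antisymm
  · refine (ContinuousLinearMap.opNorm_comp_le _ _).trans ?_
    refine (mul_le_mul hJ (ContinuousLinearMap.opNorm_comp_le _ _) (norm_nonneg _)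
      zero_le_one).trans ?_
    rw [one_mul]
    exact mul_le_of_le_one_right (norm_nonneg _) hJ'
  · have hM : Matrix.toEuclideanCLM (n := Fin N) (𝕜 := ℂ) M =
        (ContinuousLinearMap.adjoint (stepEmb h N)).comp ((stepOp h M).comp (stepEmb h N)) := by
      ext1 v
      have h1 := fun u => DFunLike.congr_fun (adjoint_comp_stepEmb (N := N) hh) u
      simp only [ContinuousLinearMap.comp_apply] at h1
      simp only [stepOp, ContinuousLinearMap.comp_apply, h1]
      rfl
    rw [specNorm, hM]
    refine (ContinuousLinearMap.opNorm_comp_le _ _).trans ?_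
    refine (mul_le_mul hJ' (ContinuousLinearMap.opNorm_comp_le _ _) (norm_nonneg _)
      zero_le_one).trans ?_
    rw [one_mul]
    exact mul_le_of_le_one_right (norm_nonneg _) hJ

theorem stepOp_mul (hh : 0 < h) (M M' : Matrix (Fin N) (Fin N) ℂ) :
    stepOp h (M * M') = stepOp h M * stepOp h M' := by
  ext1 w
  have h1 := fun u => DFunLike.congr_fun (adjoint_comp_stepEmb (N := N) hh) u
  simp only [ContinuousLinearMap.comp_apply] at h1
  simp only [stepOp, ContinuousLinearMap.comp_apply, mul_apply_eq_comp, h1, map_mul]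
  rfl

/-- `stepOp` as a linear map. -/
def stepOpLin (h : ℝ) (N : ℕ) : Matrix (Fin N) (Fin N) ℂ →ₗ[ℂ] (L2 h →L[ℂ] L2 h) where
  toFun := stepOp h
  map_add' M M' := by
    ext1 w
    simp [stepOp]
  map_smul' c M := by
    ext1 w
    simp [stepOp]

theorem stepOpLin_apply (M : Matrix (Fin N) (Fin N) ℂ) : stepOpLin h N M = stepOp h M := rfl

theorem continuous_stepOpLin : Continuous (stepOpLin h N) :=
  LinearMap.continuous_of_finiteDimensional _

theorem sum_indicator_cell (hh : 0 < h) (hN : 0 < N) (g : ℕ → ℂ) {θ : ℝ}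
    (hθ : θ ∈ Set.Ico (0 : ℝ) h) :
    ∑ i : Fin N, (cell h N i).indicator (fun _ => g i) θ = g ⌊θ / (h / N)⌋₊ := by
  rw [Finset.sum_eq_single ⟨⌊θ / (h / N)⌋₊, floor_div_lt hh hN hθ⟩]
  · exact Set.indicator_of_mem ((mem_cell_iff hh hN hθ.1).2 rfl) _
  · intro i _ hi
    refine Set.indicator_of_notMem (fun hmem => hi (Fin.ext ?_)) _
    exact ((mem_cell_iff hh hN hθ.1).1 hmem).symm
  · simp

theorem stepEmb_ae (hh : 0 < h) (hN : 0 < N) (v : EuclideanSpace ℂ (Fin N)) (g : ℕ → ℂ)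
    (hv : ∀ i : Fin N, v i = g i) :
    (stepEmb h N v : ℝ → ℂ) =ᵐ[volume.restrict (Set.Ico (0 : ℝ) h)]
      fun θ => (((Real.sqrt (h / N))⁻¹ : ℝ) : ℂ) * g ⌊θ / (h / N)⌋₊ := by
  rw [stepEmb_apply]
  have h1 : ∀ i : Fin N, ((v i • cellVec h N i : L2 h) : ℝ → ℂ)
      =ᵐ[volume.restrict (Set.Ico (0 : ℝ) h)] fun θ =>
        (((Real.sqrt (h / N))⁻¹ : ℝ) : ℂ) * (cell h N i).indicator (fun _ => g i) θ := by
    intro i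
    filter_upwards [Lp.coeFn_smul (v i) (cellVec h N i), indicatorConstLp_coeFn (p := 2)
      (hs := measurableSet_cell h N i) (hμs := measure_ne_top _ _)
      (c := (((Real.sqrt (h / N))⁻¹ : ℝ) : ℂ)) (μ := volume.restrict (Set.Ico (0 : ℝ) h))]
      with θ e1 e2
    rw [e1, Pi.smul_apply, cellVec, e2, hv]
    by_cases hθ : θ ∈ cell h N i <;> simp [hθ, mul_comm]
  filter_upwards [Lp.coeFn_finsetSum Finset.univ (fun i => v i • cellVec h N i),
    ae_all_iff.2 h1, ae_restrict_mem measurableSet_Ico] with θ e1 e2 hθ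
  rw [e1, Finset.sum_apply]
  simp only [e2]
  rw [← Finset.mul_sum, sum_indicator_cell hh hN g hθ]

theorem adjoint_stepEmb_apply (w : L2 h) (j : Fin N) :
    ContinuousLinearMap.adjoint (stepEmb h N) w j =
      (((Real.sqrt (h / N))⁻¹ : ℝ) : ℂ) *
        ∫ τ in Set.Ico (0 : ℝ) h, (cell h N j).indicator w τ := by
  have h1 : ContinuousLinearMap.adjoint (stepEmb h N) w j
      = inner ℂ (EuclideanSpace.single j (1 : ℂ)) (ContinuousLinearMap.adjoint (stepEmb h N) w) := by
    rw [EuclideanSpace.inner_single_left]; simp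
  have h2 : stepEmb h N (EuclideanSpace.single j (1 : ℂ)) = cellVec h N j := by
    rw [stepEmb_apply, Finset.sum_eq_single j] <;> simp +contextual
  rw [h1, ContinuousLinearMap.adjoint_inner_right, h2, cellVec,
    L2.inner_indicatorConstLp_eq_inner_setIntegral, integral_indicator (measurableSet_cell _ _ _),
    RCLike.inner_apply, Complex.conj_ofReal, mul_comm]

/-- A matrix with entries `g i j` acts on step functions as the integral operator whose kernel has
the value `(h / N)⁻¹ g i j` on the product of the cells `i` and `j`. -/
theorem isIntOp_stepOp (hh : 0 < h) (hN : 0 < N) (M : Matrix (Fin N) (Fin N) ℂ) (g : ℕ → ℕ → ℂ)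
    (hM : ∀ i j : Fin N, M i j = g i j) :
    IsIntOp h (fun θ τ => (((h / N : ℝ) : ℂ))⁻¹ * g ⌊θ / (h / N)⌋₊ ⌊τ / (h / N)⌋₊)
      (stepOp h M) := by
  intro w
  have hδ : 0 < h / (N : ℝ) := by positivity
  set s : ℂ := (((Real.sqrt (h / N))⁻¹ : ℝ) : ℂ) with hs
  have hss : s * s = (((h / N : ℝ) : ℂ))⁻¹ := by
    rw [hs, ← Complex.ofReal_mul, ← mul_inv, Real.mul_self_sqrt hδ.le, Complex.ofReal_inv]
  set v := ContinuousLinearMap.adjoint (stepEmb h N) w with hv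
  have hMv : ∀ i : Fin N, Matrix.toEuclideanCLM (n := Fin N) (𝕜 := ℂ) M v i
      = (fun a : ℕ => ∑ j : Fin N, g a j * v j) i := fun i => by
    rw [Matrix.ofLp_toEuclideanCLM]
    simp [Matrix.mulVec, dotProduct, hM]
  filter_upwards [stepEmb_ae hh hN _ (fun a : ℕ => ∑ j : Fin N, g a j * v j) hMv] with θ hθ
  have h1 : stepOp h M w = stepEmb h N (Matrix.toEuclideanCLM (n := Fin N) (𝕜 := ℂ) M v) := rfl
  rw [h1, hθ]
  set a := ⌊θ / (h / N)⌋₊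
  have h2 : ∫ τ in Set.Ico (0 : ℝ) h, (((h / N : ℝ) : ℂ))⁻¹ * g a ⌊τ / (h / N)⌋₊ * w τ
      = ∫ τ in Set.Ico (0 : ℝ) h, ∑ j : Fin N,
          (((h / N : ℝ) : ℂ))⁻¹ * g a j * (cell h N j).indicator w τ := by
    refine integral_congr_ae ?_
    filter_upwards [ae_restrict_mem measurableSet_Ico] with τ hτ
    rw [← sum_indicator_cell hh hN (g a) hτ, Finset.mul_sum, Finset.sum_mul]
    refine Finset.sum_congr rfl fun j _ => ?_
    by_cases hj : τ ∈ cell h N j <;> simp [hj]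
  rw [h2, integral_finsetSum, Finset.mul_sum]
  · refine Finset.sum_congr rfl fun j _ => ?_
    rw [integral_const_mul, hv, adjoint_stepEmb_apply, ← hss]
    ring
  · intro j _
    exact ((integrable_L2 w).indicator (measurableSet_cell _ _ _)).const_mul _

theorem isBddKernel_step (hh : 0 < h) (hN : 0 < N) (c : ℂ) (g : ℕ → ℕ → ℂ) :
    IsBddKernel h (fun θ τ => c * g ⌊θ / (h / N)⌋₊ ⌊τ / (h / N)⌋₊) := by
  constructor
  · refine Measurable.const_mul ?_ c
    have h1 : Measurable (Function.uncurry g) := measurable_from_prod_countable_left fun _ =>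
      measurable_of_countable _
    exact h1.comp ((Nat.measurable_floor.comp (measurable_fst.div_const _)).prodMk
      (Nat.measurable_floor.comp (measurable_snd.div_const _)))
  · refine ⟨∑ i ∈ Finset.range N, ∑ j ∈ Finset.range N, ‖c * g i j‖, fun θ hθ τ hτ => ?_⟩
    have hi := Finset.mem_range.2 (floor_div_lt hh hN hθ)
    have hj := Finset.mem_range.2 (floor_div_lt hh hN hτ)
    refine le_trans ?_ (Finset.single_le_sum (f := fun i => ∑ j ∈ Finset.range N, ‖c * g i j‖)
      (fun i _ => Finset.sum_nonneg fun j _ => norm_nonneg _) hi)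
    exact Finset.single_le_sum (f := fun j => ‖c * g ⌊θ / (h / N)⌋₊ j‖)
      (fun j _ => norm_nonneg _) hj

end StepFunctions

/-! ### Convergence of fast-sampled kernels -/

section Convergence

/-- The causal extension of `f` by zero to negative times. -/
def causal (f : ℝ → ℝ) (t : ℝ) : ℂ := if 0 ≤ t then (f t : ℂ) else 0

/-- The kernel of the `k`-th operator in the lifted impulse response of the convolution with the
causal function `f`. -/
def pieceKernel (f : ℝ → ℝ) (h : ℝ) (k : ℕ) (θ τ : ℝ) : ℂ := causal f ((k : ℝ) * h + θ - τ)

theorem measurable_causal {f : ℝ → ℝ} (hf : Continuous f) : Measurable (causal f) :=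
  Measurable.ite measurableSet_Ici (Complex.continuous_ofReal.comp hf).measurable
    measurable_const

variable {h : ℝ} {f : ℝ → ℝ} {c : ℕ → ℝ}

theorem sub_mem_window {k : ℕ} {θ τ : ℝ} (hθ : θ ∈ Set.Ico (0 : ℝ) h)
    (hτ : τ ∈ Set.Ico (0 : ℝ) h) (h0 : 0 ≤ (k : ℝ) * h + θ - τ) :
    (k : ℝ) * h + θ - τ ∈ window h k := by
  obtain ⟨h1, h2⟩ := hθ
  obtain ⟨h3, h4⟩ := hτ
  refine ⟨?_, by linarith⟩
  rcases k with _ | k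
  · simpa using h0
  · push_cast [Nat.add_sub_cancel]
    linarith

namespace IsDecaying

theorem nonneg (hf : IsDecaying f h c) (hh : 0 < h) (k : ℕ) : 0 ≤ c k := by
  refine (abs_nonneg _).trans (hf.bound k ((k : ℝ) * h) ⟨?_, by linarith⟩)
  gcongr
  omega

theorem norm_pieceKernel_le (hf : IsDecaying f h c) (hh : 0 < h) (k : ℕ) {θ τ : ℝ}
    (hθ : θ ∈ Set.Ico (0 : ℝ) h) (hτ : τ ∈ Set.Ico (0 : ℝ) h) :
    ‖pieceKernel f h k θ τ‖ ≤ c k := by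
  rw [pieceKernel, causal]
  split_ifs with h0
  · rw [Complex.norm_real]
    exact hf.bound k _ (sub_mem_window hθ hτ h0)
  · simpa using hf.nonneg hh k

theorem isBddKernel (hf : IsDecaying f h c) (hh : 0 < h) (k : ℕ) :
    IsBddKernel h (pieceKernel f h k) := by
  refine ⟨(measurable_causal hf.continuous).comp ?_, c k, fun θ hθ τ hτ =>
    hf.norm_pieceKernel_le hh k hθ hτ⟩
  exact (measurable_fst.const_add _).sub measurable_snd

end IsDecaying

/-- Freezing the first argument of a kernel at `0` samples the output at the start of the
period. -/
theorem IsBddKernel.freeze (hh : 0 < h) {k : ℝ → ℝ → ℂ} (hk : IsBddKernel h k) :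
    IsBddKernel h (fun _ τ => k 0 τ) := by
  obtain ⟨M, hM⟩ := hk.bounded
  exact ⟨(hk.measurable_row 0).comp measurable_snd, M, fun _ _ τ hτ =>
    hM 0 ⟨le_rfl, hh⟩ τ hτ⟩

theorem IsBddKernel.norm_intOp_le (hh : 0 ≤ h) {k : ℝ → ℝ → ℂ} (hk : IsBddKernel h k) {M : ℝ}
    (hM0 : 0 ≤ M) (hM : ∀ θ ∈ Set.Ico (0 : ℝ) h, ∀ τ ∈ Set.Ico (0 : ℝ) h, ‖k θ τ‖ ≤ M) :
    ‖intOp h k‖ ≤ h * M := by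
  have h1 := (hk.isIntOp hh).norm_le hh hk (c := Real.sqrt h * M) (by positivity) fun θ hθ => by
    calc ∫ τ in Set.Ico (0 : ℝ) h, ‖k θ τ‖ ^ 2 ≤ ∫ τ in Set.Ico (0 : ℝ) h, M ^ 2 := by
          refine integral_mono_of_nonneg (ae_of_all _ fun τ => by positivity)
            (integrable_const _) ?_
          filter_upwards [ae_restrict_mem measurableSet_Ico] with τ hτ
          exact pow_le_pow_left₀ (norm_nonneg _) (hM θ hθ τ hτ) 2
      _ = (Real.sqrt h * M) ^ 2 := by simp [hh, mul_pow]
  rwa [← mul_assoc, Real.mul_self_sqrt hh] at h1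

/-- The kernel of the fast-sampled response is close to the true one. Off the diagonal cells both
are values or mean values of `f` at times that differ by at most two sampling intervals. The
diagonal cells are where the kernel is discontinuous, and there only a bound is available. -/
theorem IsDecaying.norm_pieceKernel_sub_toeplitz_le (hf : IsDecaying f h c) (hh : 0 < h) {N : ℕ}
    (hN : 0 < N) {η : ℕ → ℝ} (hη0 : η 0 = 0)
    (hη : ∀ n : ℕ, η (n + 1) = ∫ t in ((n : ℝ) * (h / N))..((n + 1 : ℝ) * (h / N)), f t)
    (k : ℕ) {θ τ : ℝ} (hθ : θ ∈ Set.Ico (0 : ℝ) h) (hτ : τ ∈ Set.Ico (0 : ℝ) h) :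
    ‖pieceKernel f h k θ τ - (((h / N : ℝ) : ℂ))⁻¹ *
        toeplitz η (k * N + ⌊θ / (h / N)⌋₊) ⌊τ / (h / N)⌋₊‖ ≤
      c k * (2 * (h / N)) + (cell h N ⌊θ / (h / N)⌋₊).indicator (fun _ => c k) τ := by
  have hN' : (0 : ℝ) < N := by exact_mod_cast hN
  set δ : ℝ := h / N with hδ
  have hδ0 : 0 < δ := by positivity
  have hck := hf.nonneg hh k
  have hhδ : h = N * δ := by rw [hδ]; field_simp
  set i := ⌊θ / δ⌋₊ with hi
  set j := ⌊τ / δ⌋₊ with hj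
  obtain ⟨hi1, hi2⟩ : (i : ℝ) * δ ≤ θ ∧ θ < ((i : ℝ) + 1) * δ :=
    (mem_cell_iff hh hN hθ.1).2 hi.symm
  have hjmem : τ ∈ cell h N j := (mem_cell_iff hh hN hτ.1).2 hj.symm
  obtain ⟨hj1, hj2⟩ : (j : ℝ) * δ ≤ τ ∧ τ < ((j : ℝ) + 1) * δ := ⟨hjmem.1, hjmem.2⟩
  have hjN : j < N := floor_div_lt hh hN hτ
  have hiN : i < N := floor_div_lt hh hN hθ
  have hind : 0 ≤ (cell h N i).indicator (fun _ => c k) τ :=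
    Set.indicator_nonneg (fun _ _ => hck) _
  have hkh : (k : ℝ) * h = (k * N : ℕ) * δ := by rw [hhδ]; push_cast; ring
  rcases lt_trichotomy (k * N + i) j with hlt | heq | hgt
  · -- the output cell precedes the input cell, so both kernels vanish
    have hle : ((k * N : ℕ) : ℝ) + i + 1 ≤ j := by exact_mod_cast hlt
    have hneg : ¬ 0 ≤ (k : ℝ) * h + θ - τ := by
      rw [hkh]
      nlinarith [mul_le_mul_of_nonneg_right hle hδ0.le]
    rw [pieceKernel, causal, if_neg hneg, toeplitz, if_neg (by omega)]
    simp only [mul_zero, sub_zero, norm_zero]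
    positivity
  · -- a diagonal cell: the sampled kernel is `η 0 = 0`, the true one is only bounded
    have hij : i = j := by
      rcases k with _ | k
      · simpa using heq
      · exfalso
        rw [Nat.succ_mul] at heq
        omega
    rw [toeplitz, if_pos heq.ge, heq, Nat.sub_self, hη0, hij,
      Set.indicator_of_mem hjmem]
    simp only [Complex.ofReal_zero, mul_zero, sub_zero]
    have := hf.norm_pieceKernel_le hh k hθ hτ
    have h2 : 0 ≤ c k * (2 * δ) := by positivity
    linarith
  · -- the sampled kernel is the mean of `f` over `[nδ, (n+1)δ]`, the true one its value at a time
    -- in `(nδ, (n+2)δ)`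
    obtain ⟨n, hn⟩ := Nat.exists_eq_add_of_lt hgt
    have hnR : ((k * N : ℕ) : ℝ) + i = j + n + 1 := by exact_mod_cast hn
    have hnδ : ((k * N : ℕ) : ℝ) * δ + i * δ = j * δ + n * δ + δ := by
      linear_combination δ * hnR
    have ht0 : 0 ≤ (k : ℝ) * h + θ - τ := by
      rw [hkh]
      have : (0 : ℝ) ≤ n * δ := by positivity
      nlinarith
    have htw := sub_mem_window hθ hτ ht0
    have hsw : ∀ s ∈ Set.Icc ((n : ℝ) * δ) (((n : ℝ) + 1) * δ), s ∈ window h k := by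
      intro s hs
      refine ⟨le_trans ?_ hs.1, hs.2.trans ?_⟩
      · have h1 : (k - 1) * N ≤ n := by
          rcases k with _ | k
          · simp
          · rw [Nat.succ_mul] at hn
            simp only [Nat.add_sub_cancel]
            omega
        have h2 : ((k - 1 : ℕ) : ℝ) * N ≤ n := by exact_mod_cast h1
        rw [hhδ, ← mul_assoc]
        exact mul_le_mul_of_nonneg_right h2 hδ0.le
      · have h1 : n + 1 ≤ (k + 1) * N := by
          rw [Nat.succ_mul]
          omega
        have h2 : (n : ℝ) + 1 ≤ ((k : ℝ) + 1) * N := by exact_mod_cast h1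
        rw [hhδ, ← mul_assoc]
        exact mul_le_mul_of_nonneg_right h2 hδ0.le
    set t := (k : ℝ) * h + θ - τ with ht
    have hint : ∫ s in ((n : ℝ) * δ)..((n + 1 : ℝ) * δ), (f t - f s)
        = δ * f t - η (n + 1) := by
      rw [intervalIntegral.integral_sub (by simp) (hf.continuous.intervalIntegrable _ _), hη n]
      simp only [intervalIntegral.integral_const, smul_eq_mul]
      ring
    have hbd : |δ * f t - η (n + 1)| ≤ c k * (2 * δ) * δ := by
      rw [← hint]
      have h1 := intervalIntegral.norm_integral_le_of_norm_le_const (a := (n : ℝ) * δ)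
        (b := (n + 1 : ℝ) * δ) (f := fun s => f t - f s) (C := c k * (2 * δ)) ?_
      · rw [show ((n : ℝ) + 1) * δ - n * δ = δ by ring, abs_of_pos hδ0] at h1
        exact h1
      · intro s hs
        rw [Set.uIoc_of_le (by nlinarith)] at hs
        refine (hf.lipschitz k t htw s (hsw s ⟨hs.1.le, hs.2⟩)).trans ?_
        refine mul_le_mul_of_nonneg_left ?_ hck
        rw [abs_le, ht, hkh]
        constructor <;> nlinarith [hs.1, hs.2]
    have hval : pieceKernel f h k θ τ - ((δ : ℝ) : ℂ)⁻¹ * toeplitz η (k * N + i) j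
        = ((δ⁻¹ * (δ * f t - η (n + 1)) : ℝ) : ℂ) := by
      rw [pieceKernel, ← ht, causal, if_pos ht0, toeplitz, if_pos hgt.le,
        show k * N + i - j = n + 1 by omega]
      have : (δ : ℂ) ≠ 0 := by exact_mod_cast hδ0.ne'
      push_cast
      field_simp
    rw [hval, Complex.norm_real, Real.norm_eq_abs, abs_mul, abs_of_pos (inv_pos.2 hδ0)]
    have h3 : δ⁻¹ * |δ * f t - η (n + 1)| ≤ c k * (2 * δ) := by
      rw [inv_mul_le_iff₀ hδ0]
      linarith
    linarith

/-- The factor `O(N^{-1/2})` by which fast sampling with `N` samples in each period scales the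
summable bounds of an impulse response to bound the error in operator norm. -/
def samplingError (h : ℝ) (N : ℕ) : ℝ :=
  Real.sqrt h * (2 * (h / N) * Real.sqrt (2 * h) + Real.sqrt (2 * (h / N)))

theorem tendsto_samplingError (h : ℝ) : Tendsto (samplingError h) atTop (𝓝 0) := by
  have h1 : Tendsto (fun N : ℕ => h / (N : ℝ)) atTop (𝓝 0) :=
    tendsto_const_div_atTop_nhds_zero_nat h
  have h2 : Continuous fun x : ℝ =>
      Real.sqrt h * (2 * x * Real.sqrt (2 * h) + Real.sqrt (2 * x)) := by fun_prop
  have h3 := (h2.tendsto 0).comp h1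
  rwa [show Real.sqrt h * (2 * 0 * Real.sqrt (2 * h) + Real.sqrt (2 * 0)) = 0 by simp] at h3

theorem integral_sq_le_of_norm_le (hh : 0 < h) {N : ℕ} (i : Fin N) {g : ℝ → ℂ} {a : ℝ}
    (_ha : 0 ≤ a)
    (hg : ∀ τ ∈ Set.Ico (0 : ℝ) h,
      ‖g τ‖ ≤ a * (2 * (h / N)) + (cell h N i).indicator (fun _ => a) τ) :
    ∫ τ in Set.Ico (0 : ℝ) h, ‖g τ‖ ^ 2 ≤
      (a * (2 * (h / N) * Real.sqrt (2 * h) + Real.sqrt (2 * (h / N)))) ^ 2 := by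
  have hN : (0 : ℝ) < N := by exact_mod_cast i.pos
  set δ : ℝ := h / N with hδ
  have hδ0 : 0 < δ := by positivity
  have hint : Integrable ((cell h N i).indicator fun _ : ℝ => 2 * a ^ 2)
      (volume.restrict (Set.Ico (0 : ℝ) h)) :=
    (integrable_const _).indicator (measurableSet_cell _ _ _)
  calc ∫ τ in Set.Ico (0 : ℝ) h, ‖g τ‖ ^ 2
      ≤ ∫ τ in Set.Ico (0 : ℝ) h, (2 * (a * (2 * δ)) ^ 2 +
          (cell h N i).indicator (fun _ => 2 * a ^ 2) τ) := by
        refine integral_mono_of_nonneg (ae_of_all _ fun τ => by positivity)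
          ((integrable_const _).add hint) ?_
        filter_upwards [ae_restrict_mem measurableSet_Ico] with τ hτ
        refine (pow_le_pow_left₀ (norm_nonneg _) (hg τ hτ) 2).trans ?_
        by_cases hm : τ ∈ cell h N i
        · simp only [Set.indicator_of_mem hm]
          nlinarith [sq_nonneg (a * (2 * δ) - a)]
        · simp only [Set.indicator_of_notMem hm]
          nlinarith [sq_nonneg (a * (2 * δ))]
    _ = 2 * (a * (2 * δ)) ^ 2 * h + 2 * a ^ 2 * δ := by
        rw [integral_add (integrable_const _) hint, integral_indicator (measurableSet_cell _ _ _)]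
        simp only [setIntegral_const, measureReal_cell hh i]
        simp [hh.le]
        ring
    _ ≤ (a * (2 * δ * Real.sqrt (2 * h) + Real.sqrt (2 * δ))) ^ 2 := by
        have h1 := Real.sq_sqrt (show 0 ≤ 2 * h by positivity)
        have h2 := Real.sq_sqrt (show 0 ≤ 2 * δ by positivity)
        have h3 : 0 ≤ a ^ 2 * (2 * δ * Real.sqrt (2 * h) * Real.sqrt (2 * δ)) := by positivity
        have h4 : (a * (2 * δ * Real.sqrt (2 * h) + Real.sqrt (2 * δ))) ^ 2
          = a ^ 2 * ((2 * δ) ^ 2 * Real.sqrt (2 * h) ^ 2 + Real.sqrt (2 * δ) ^ 2) +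
            2 * (a ^ 2 * (2 * δ * Real.sqrt (2 * h) * Real.sqrt (2 * δ))) := by ring
        rw [h4, h1, h2]
        nlinarith

/-- Row-wise `L²` bounds for the differences of kernels add up to a bound for the difference of
the transfer functions. -/
theorem norm_stepOp_sub_le (hh : 0 < h) {N : ℕ} (hN : 0 < N) {κ : ℕ → ℝ → ℝ → ℂ}
    (hκ : ∀ k, IsBddKernel h (κ k)) {g : ℕ → ℕ → ℕ → ℂ} (hc : Summable c) (hc0 : ∀ k, 0 ≤ c k)
    {M : Matrix (Fin N) (Fin N) ℂ} {T : L2 h →L[ℂ] L2 h} {z : ℂ} (hz : ‖z‖ = 1)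
    (hrow : ∀ k, ∀ θ ∈ Set.Ico (0 : ℝ) h, ∃ i : Fin N, ∀ τ ∈ Set.Ico (0 : ℝ) h,
      ‖κ k θ τ - (((h / N : ℝ) : ℂ))⁻¹ * g k ⌊θ / (h / N)⌋₊ ⌊τ / (h / N)⌋₊‖ ≤
        c k * (2 * (h / N)) + (cell h N i).indicator (fun _ => c k) τ)
    (hM : ∀ i j : Fin N, HasSum (fun k => (z ^ k)⁻¹ * g k i j) (M i j))
    (hT : HasSum (fun k => (z ^ k)⁻¹ • intOp h (κ k)) T) :
    ‖stepOp h M - T‖ ≤ samplingError h N * ∑' k, c k := by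
  set Mk : ℕ → Matrix (Fin N) (Fin N) ℂ := fun k => Matrix.of fun i j => g k i j with hMk
  have hMsum : HasSum (fun k => (z ^ k)⁻¹ • Mk k) M := by
    refine Pi.hasSum.2 fun i => Pi.hasSum.2 fun j => ?_
    exact hM i j
  have h1 : HasSum (fun k => (z ^ k)⁻¹ • stepOp h (Mk k)) (stepOp h M) := by
    have := hMsum.map (stepOpLin h N) continuous_stepOpLin
    refine this.congr_fun fun k => ?_
    rw [Function.comp_apply, map_smul, stepOpLin_apply]
  have h2 := h1.sub hT
  refine h2.norm_le_of_bounded (hc.hasSum.mul_left (samplingError h N)) fun k => ?_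
  rw [← smul_sub, norm_smul, norm_inv, norm_pow, hz, one_pow, inv_one, one_mul, ← norm_neg,
    neg_sub]
  have hs := isIntOp_stepOp hh hN (Mk k) (g k) (fun i j => rfl)
  have hsb := isBddKernel_step hh hN (((h / N : ℝ) : ℂ))⁻¹ (g k)
  have hk := (hκ k).isIntOp hh.le
  have hck := hc0 k
  refine ((hk.sub hs (hκ k) hsb).norm_le hh.le ((hκ k).sub hsb)
    (c := c k * (2 * (h / N) * Real.sqrt (2 * h) + Real.sqrt (2 * (h / N)))) ?_
    fun θ hθ => ?_).trans_eq ?_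
  · positivity
  · obtain ⟨i, hi⟩ := hrow k θ hθ
    exact integral_sq_le_of_norm_le hh i hck hi
  · rw [samplingError]
    ring

end Convergence

/-! ### Responses split into periods -/

section TimeDomain

variable {h : ℝ}

theorem hasSum_cauchyProduct {R : Type*} [NormedRing R] [NormedAlgebra ℂ R] [CompleteSpace R]
    {a b : ℕ → R} {s t : R} {z : ℂ} (hz : ‖z‖ = 1)
    (ha : Summable fun k => ‖a k‖) (hb : Summable fun k => ‖b k‖)
    (hs : HasSum (fun k => (z ^ k)⁻¹ • a k) s) (ht : HasSum (fun k => (z ^ k)⁻¹ • b k) t) :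
    HasSum (fun k => (z ^ k)⁻¹ • ∑ j ∈ Finset.range (k + 1), a j * b (k - j)) (s * t) := by
  have ha' : Summable fun k => ‖(z ^ k)⁻¹ • a k‖ := by simpa [norm_smul, hz] using ha
  have hb' : Summable fun k => ‖(z ^ k)⁻¹ • b k‖ := by simpa [norm_smul, hz] using hb
  have h1 := hasSum_sum_range_mul_of_summable_norm ha' hb'
  rw [hs.tsum_eq, ht.tsum_eq] at h1
  refine h1.congr_fun fun k => ?_
  rw [Finset.smul_sum]
  refine Finset.sum_congr rfl fun j hj => ?_
  have hjk : j + (k - j) = k := by have := Finset.mem_range.1 hj; omega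
  rw [smul_mul_smul_comm, ← mul_inv, ← pow_add, hjk]

theorem hasSum_delay {E : Type*} [NormedAddCommGroup E] [NormedSpace ℂ E] {a : ℕ → E} {s : E}
    {z : ℂ} (hs : HasSum (fun k => (z ^ k)⁻¹ • a k) s) (m : ℕ) :
    HasSum (fun k => (z ^ k)⁻¹ • if m ≤ k then a (k - m) else 0) ((z ^ m)⁻¹ • s) := by
  rw [← hasSum_nat_add_iff' m]
  have h0 : ∑ k ∈ Finset.range m, ((z ^ k)⁻¹ • if m ≤ k then a (k - m) else 0) = 0 :=
    Finset.sum_eq_zero fun k hk => by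
      rw [if_neg (by have := Finset.mem_range.1 hk; omega), smul_zero]
  rw [h0, sub_zero]
  refine (hs.const_smul (z ^ m)⁻¹).congr_fun fun k => ?_
  rw [if_pos (Nat.le_add_left m k), Nat.add_sub_cancel, smul_smul, pow_add, mul_inv, mul_comm]

theorem contUnlift_single (hh : 0 < h) (w : ℝ → ℂ) {t : ℝ} (ht : 0 ≤ t) :
    contUnlift h (Pi.single 0 w) t = (Set.Ico (0 : ℝ) h).indicator w t := by
  rw [contUnlift, if_pos ht]
  by_cases hth : t < h
  · have : ⌊t / h⌋₊ = 0 := Nat.floor_eq_zero.2 ((div_lt_one hh).2 hth)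
    rw [this, Set.indicator_of_mem (show t ∈ Set.Ico 0 h from ⟨ht, hth⟩)]
    simp
  · have : ⌊t / h⌋₊ ≠ 0 := by
      rw [Ne, Nat.floor_eq_zero, div_lt_one hh]
      exact hth
    rw [Set.indicator_of_notMem (fun hmem => hth hmem.2), Pi.single_eq_of_ne this]
    rfl

theorem intervalIntegral_eq_causal (f : ℝ → ℝ) (u : ℝ → ℂ) {t b : ℝ} (ht : 0 ≤ t) (htb : t < b) :
    ∫ τ in (0 : ℝ)..t, (f (t - τ) : ℂ) * u τ
      = ∫ τ in Set.Ico (0 : ℝ) b, causal f (t - τ) * u τ := by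
  rw [intervalIntegral.integral_of_le ht, ← integral_Icc_eq_integral_Ioc,
    ← integral_indicator measurableSet_Icc, ← integral_indicator measurableSet_Ico]
  congr 1
  ext τ
  by_cases h1 : τ ∈ Set.Icc 0 t
  · rw [Set.indicator_of_mem h1, Set.indicator_of_mem
      (show τ ∈ Set.Ico 0 b from ⟨h1.1, h1.2.trans_lt htb⟩), causal,
      if_pos (sub_nonneg.2 h1.2)]
  · rw [Set.indicator_of_notMem h1]
    by_cases h2 : τ ∈ Set.Ico 0 b
    · rw [Set.indicator_of_mem h2, causal, if_neg, zero_mul]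
      exact fun h3 => h1 ⟨h2.1, sub_nonneg.1 h3⟩
    · rw [Set.indicator_of_notMem h2]

/-- The response of a strictly proper system to an input supported in the first period. -/
theorem contApply_single (hh : 0 < h) {n : ℕ} (S : SISO n) (hS : S.D = 0) (w : ℝ → ℂ) (t : ℝ) :
    S.contApply (contUnlift h (Pi.single 0 w)) t
      = ∫ τ in Set.Ico (0 : ℝ) h, causal S.contImpulse (t - τ) * w τ := by
  rw [StateSpace.contApply]
  split_ifs with ht
  · -- both the time `t` and the support `[0, h)` of the input lie below this bound
    have hb : t < max h (t + 1) := lt_max_of_lt_right (by linarith)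
    have h1 := intervalIntegral_eq_causal S.contImpulse (contUnlift h (Pi.single 0 w)) ht hb
    simp only [StateSpace.contImpulse, sandwich_apply] at h1
    rw [hS, h1]
    simp only [Matrix.zero_apply, Complex.ofReal_zero, zero_mul, zero_add]
    rw [← integral_indicator measurableSet_Ico, ← integral_indicator measurableSet_Ico]
    congr 1
    ext τ
    by_cases h2 : τ ∈ Set.Ico 0 h
    · have h3 : τ ∈ Set.Ico 0 (max h (t + 1)) := ⟨h2.1, h2.2.trans_le (le_max_left _ _)⟩
      rw [Set.indicator_of_mem h2, Set.indicator_of_mem h3, contUnlift_single hh w h2.1,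
        Set.indicator_of_mem h2]
    · rw [Set.indicator_of_notMem h2]
      by_cases h3 : τ ∈ Set.Ico 0 (max h (t + 1))
      · rw [Set.indicator_of_mem h3, contUnlift_single hh w h3.1, Set.indicator_of_notMem h2,
          mul_zero]
      · rw [Set.indicator_of_notMem h3]
  · rw [eq_comm]
    refine setIntegral_eq_zero_of_forall_eq_zero fun τ hτ => ?_
    rw [causal, if_neg (by linarith [hτ.1]), zero_mul]

/-- A convolution over `[0, kh + θ]` split into periods. -/
theorem integral_eq_sum_pieceKernel (hh : 0 < h) {g : ℝ → ℝ} {c : ℕ → ℝ} (hg : IsDecaying g h c)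
    {u : ℝ → ℂ} (hu : StronglyMeasurable u)
    (hub : ∀ j : ℕ, ∃ M, ∀ σ ∈ Set.Ico (0 : ℝ) h, ‖u ((j : ℝ) * h + σ)‖ ≤ M)
    (k : ℕ) {θ : ℝ} (hθ : θ ∈ Set.Ico (0 : ℝ) h) :
    ∫ τ in (0 : ℝ)..((k : ℝ) * h + θ), (g ((k : ℝ) * h + θ - τ) : ℂ) * u τ
      = ∑ j ∈ Finset.range (k + 1),
          ∫ σ in Set.Ico (0 : ℝ) h, pieceKernel g h (k - j) θ σ * u ((j : ℝ) * h + σ) := by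
  have ht0 : 0 ≤ (k : ℝ) * h + θ := add_nonneg (by positivity) hθ.1
  have htb : (k : ℝ) * h + θ < ((k + 1 : ℕ) : ℝ) * h := by push_cast; linarith [hθ.2]
  rw [intervalIntegral_eq_causal g u ht0 htb, integral_Ico_eq_integral_Ioc,
    ← intervalIntegral.integral_of_le (by positivity)]
  set φ : ℝ → ℂ := fun τ => causal g ((k : ℝ) * h + θ - τ) * u τ with hφ
  have hφm : StronglyMeasurable φ :=
    ((measurable_causal hg.continuous).comp (measurable_id.const_sub _)).stronglyMeasurable.mul hu
  have hφj : ∀ j ≤ k, ∀ σ, φ ((j : ℝ) * h + σ)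
      = pieceKernel g h (k - j) θ σ * u ((j : ℝ) * h + σ) := by
    intro j hj σ
    rw [hφ, pieceKernel]
    simp only []
    congr 2
    rw [Nat.cast_sub hj]
    ring
  have hint : ∀ j < k + 1, IntervalIntegrable φ volume ((j : ℝ) * h) (((j + 1 : ℕ) : ℝ) * h) := by
    intro j hj
    have hle : (j : ℝ) * h ≤ ((j + 1 : ℕ) : ℝ) * h := by push_cast; nlinarith
    rw [intervalIntegrable_iff_integrableOn_Ico_of_le hle]
    obtain ⟨M, hM⟩ := hub j
    refine Measure.integrableOn_of_bounded (M := c (k - j) * M) (by simp)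
      hφm.aestronglyMeasurable ?_
    filter_upwards [ae_restrict_mem measurableSet_Ico] with τ hτ
    have hσ : τ - (j : ℝ) * h ∈ Set.Ico (0 : ℝ) h := by
      obtain ⟨h1, h2⟩ := hτ
      push_cast at h2
      exact ⟨by linarith, by linarith⟩
    have h1 := hφj j (by omega) (τ - (j : ℝ) * h)
    have h2 := hM _ hσ
    rw [add_sub_cancel] at h1 h2
    rw [h1, norm_mul]
    exact mul_le_mul (hg.norm_pieceKernel_le hh _ hθ hσ) h2 (norm_nonneg _) (hg.nonneg hh _)
  have hsum := intervalIntegral.sum_integral_adjacent_intervals (f := φ)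
    (a := fun j : ℕ => (j : ℝ) * h) (n := k + 1) hint
  rw [Nat.cast_zero, zero_mul] at hsum
  rw [← hsum]
  refine Finset.sum_congr rfl fun j hj => ?_
  have hj' : j ≤ k := by have := Finset.mem_range.1 hj; omega
  have h1 := intervalIntegral.integral_comp_add_left (a := 0) (b := h) φ ((j : ℝ) * h)
  rw [add_zero, show (j : ℝ) * h + h = ((j + 1 : ℕ) : ℝ) * h by push_cast; ring] at h1
  rw [← h1, intervalIntegral.integral_of_le hh.le, integral_Ico_eq_integral_Ioc]
  simp only [hφj j hj']

/-- The output of a filter whose input is upsampled, in terms of the polyphase components of its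
impulse response. -/
theorem discApply_upsample {n : ℕ} (S : SISO n) {L : ℕ} (s : ℕ → ℂ) (k : ℕ) {l : ℕ} (hl : l < L) :
    S.discApply (upsample L s) (k * L + l)
      = ∑ a ∈ Finset.range (k + 1), (S.impulse (a * L + l) : ℂ) * s (k - a) := by
  rw [StateSpace.discApply]
  symm
  refine Finset.sum_of_injOn (fun a => a * L + l) ?_ ?_ ?_ ?_
  · intro a _ b _ hab
    have : a * L = b * L := Nat.add_right_cancel hab
    exact Nat.eq_of_mul_eq_mul_right (by omega) this
  · intro a ha
    have ha' : a ≤ k := by have := Finset.mem_range.1 ha; omega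
    have := Nat.mul_le_mul_right L ha'
    simp only [Finset.coe_range, Set.mem_Iio]
    omega
  · intro i hi hni
    have hi' := Finset.mem_range.1 hi
    rw [upsample, if_neg, mul_zero]
    rintro ⟨q, hq⟩
    have hqk : q ≤ k := by
      by_contra hcon
      have : (k + 1) * L ≤ q * L := Nat.mul_le_mul_right L (by omega)
      rw [Nat.succ_mul, mul_comm q] at this
      omega
    refine hni ⟨k - q, by simp, ?_⟩
    have h1 := Nat.mul_le_mul_right L hqk
    rw [mul_comm L q] at hq
    simp only [Nat.sub_mul]
    omega
  · intro a ha
    have ha' : a ≤ k := by have := Finset.mem_range.1 ha; omega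
    have h1 : k * L + l - (a * L + l) = L * (k - a) := by
      rw [mul_comm L, Nat.sub_mul]
      omega
    rw [h1, upsample, if_pos (dvd_mul_right _ _), Nat.mul_div_cancel_left _ (by omega)]

end TimeDomain

/-! ### The lifted multirate error system -/

section LiftedSystem

variable {h : ℝ}

/-- The lifted impulse response of the convolution with the causal function `f`. -/
def pieceOp (f : ℝ → ℝ) (h : ℝ) (k : ℕ) : L2 h →L[ℂ] L2 h := intOp h (pieceKernel f h k)

/-- The `k`-th sample of the response to an input on `[0, h)`, as a constant function. -/
def sampleOp (f : ℝ → ℝ) (h : ℝ) (k : ℕ) : L2 h →L[ℂ] L2 h :=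
  intOp h (fun _ τ => pieceKernel f h k 0 τ)

/-- The mean value over `[0, h)` times the indicator function of the `l`-th of `L` cells. -/
def blockOp (h : ℝ) (L l : ℕ) : L2 h →L[ℂ] L2 h :=
  intOp h (fun θ _ => (h : ℂ)⁻¹ * (cell h L l).indicator (fun _ => 1) θ)

theorem isBddKernel_block (h : ℝ) (L l : ℕ) :
    IsBddKernel h (fun θ _ => (h : ℂ)⁻¹ * (cell h L l).indicator (fun _ => 1) θ) := by
  refine ⟨?_, ‖(h : ℂ)⁻¹‖, fun θ _ τ _ => ?_⟩
  · exact ((measurable_const.indicator (measurableSet_cell _ _ _)).comp measurable_fst).const_mul _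
  · rw [norm_mul]
    refine mul_le_of_le_one_right (norm_nonneg _) ?_
    by_cases hθ : θ ∈ cell h L l <;> simp [hθ]

variable {f : ℝ → ℝ} {c : ℕ → ℝ}

theorem IsDecaying.isIntOp_pieceOp (hf : IsDecaying f h c) (hh : 0 < h) (k : ℕ) :
    IsIntOp h (pieceKernel f h k) (pieceOp f h k) := (hf.isBddKernel hh k).isIntOp hh.le

theorem IsDecaying.isIntOp_sampleOp (hf : IsDecaying f h c) (hh : 0 < h) (k : ℕ) :
    IsIntOp h (fun _ τ => pieceKernel f h k 0 τ) (sampleOp f h k) :=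
  ((hf.isBddKernel hh k).freeze hh).isIntOp hh.le

theorem IsDecaying.norm_pieceOp_le (hf : IsDecaying f h c) (hh : 0 < h) (k : ℕ) :
    ‖pieceOp f h k‖ ≤ h * c k :=
  (hf.isBddKernel hh k).norm_intOp_le hh.le (hf.nonneg hh k) fun _ hθ _ hτ =>
    hf.norm_pieceKernel_le hh k hθ hτ

theorem IsDecaying.norm_sampleOp_le (hf : IsDecaying f h c) (hh : 0 < h) (k : ℕ) :
    ‖sampleOp f h k‖ ≤ h * c k :=
  ((hf.isBddKernel hh k).freeze hh).norm_intOp_le hh.le (hf.nonneg hh k) fun _ _ _ hτ =>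
    hf.norm_pieceKernel_le hh k ⟨le_rfl, hh⟩ hτ

theorem IsDecaying.summable_norm_pieceOp (hf : IsDecaying f h c) (hh : 0 < h) :
    Summable fun k => ‖pieceOp f h k‖ :=
  Summable.of_nonneg_of_le (fun _ => norm_nonneg _) (hf.norm_pieceOp_le hh)
    (hf.summable.mul_left h)

theorem IsDecaying.summable_norm_sampleOp (hf : IsDecaying f h c) (hh : 0 < h) :
    Summable fun k => ‖sampleOp f h k‖ :=
  Summable.of_nonneg_of_le (fun _ => norm_nonneg _) (hf.norm_sampleOp_le hh)
    (hf.summable.mul_left h)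

/-- The response of the system `F` to an input on the first period. -/
def firstResponse {n : ℕ} (F : SISO n) (h : ℝ) (w : ℝ → ℂ) : ℝ → ℂ :=
  F.contApply (contUnlift h (Pi.single 0 w))

section Response

variable {n : ℕ} {F : SISO n}

theorem firstResponse_eq (hh : 0 < h) (hFD : F.D = 0) (w : ℝ → ℂ) (k : ℕ) (θ : ℝ) :
    firstResponse F h w ((k : ℝ) * h + θ)
      = ∫ τ in Set.Ico (0 : ℝ) h, pieceKernel F.contImpulse h k θ τ * w τ :=
  contApply_single hh F hFD w _

theorem stronglyMeasurable_firstResponse (hh : 0 < h) (hFD : F.D = 0) (w : L2 h) :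
    StronglyMeasurable (firstResponse F h w) := by
  have : firstResponse F h w
      = fun t => ∫ τ in Set.Ico (0 : ℝ) h, causal F.contImpulse (t - τ) * w τ :=
    funext (contApply_single hh F hFD w)
  rw [this]
  refine StronglyMeasurable.integral_prod_right
    (f := fun t τ => causal F.contImpulse (t - τ) * w τ) ?_
  refine StronglyMeasurable.mul ?_ ((Lp.stronglyMeasurable w).comp_measurable measurable_snd)
  exact ((measurable_causal F.continuous_contImpulse).comp
    (measurable_fst.sub measurable_snd)).stronglyMeasurable

theorem exists_firstResponse_bound (hh : 0 < h) (hFD : F.D = 0)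
    (hF : IsDecaying F.contImpulse h c) (w : L2 h) (k : ℕ) :
    ∃ M, ∀ θ ∈ Set.Ico (0 : ℝ) h, ‖firstResponse F h w ((k : ℝ) * h + θ)‖ ≤ M := by
  obtain ⟨M, hM⟩ := (hF.isBddKernel hh k).exists_integral_bound w
  refine ⟨M, fun θ hθ => ?_⟩
  rw [firstResponse_eq hh hFD]
  exact hM θ hθ

theorem pieceOp_ae (hh : 0 < h) (hFD : F.D = 0) (hF : IsDecaying F.contImpulse h c) (w : L2 h)
    (k : ℕ) : (pieceOp F.contImpulse h k w : ℝ → ℂ)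
      =ᵐ[volume.restrict (Set.Ico (0 : ℝ) h)] fun θ => firstResponse F h w ((k : ℝ) * h + θ) := by
  filter_upwards [hF.isIntOp_pieceOp hh k w] with θ hθ
  rw [hθ, firstResponse_eq hh hFD]

end Response

/-- The lifted impulse response of a continuous-time system, direct term included. -/
def systemOp {n : ℕ} (G : SISO n) (h : ℝ) (k : ℕ) : L2 h →L[ℂ] L2 h :=
  pieceOp G.contImpulse h k + if k = 0 then ((G.D () () : ℝ) : ℂ) • 1 else 0

theorem coeFn_sum_apply {ι : Type*} (s : Finset ι) (A : ι → L2 h →L[ℂ] L2 h) (w : L2 h)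
    (φ : ι → ℝ → ℂ)
    (hφ : ∀ i ∈ s, (A i w : ℝ → ℂ) =ᵐ[volume.restrict (Set.Ico (0 : ℝ) h)] φ i) :
    ((∑ i ∈ s, A i) w : L2 h) =ᵐ[volume.restrict (Set.Ico (0 : ℝ) h)]
      fun θ => ∑ i ∈ s, φ i θ := by
  rw [sum_apply]
  filter_upwards [Lp.coeFn_finsetSum s (fun i => A i w),
    (ae_ball_iff s.countable_toSet).2 hφ] with θ h1 h2
  rw [h1, Finset.sum_apply]
  exact Finset.sum_congr rfl fun i hi => h2 i hi

/-- Lifting turns the cascade of two continuous-time systems into the convolution of their lifted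
impulse responses. -/
theorem cascade_ae (hh : 0 < h) {nG nF : ℕ} {G : SISO nG} {F : SISO nF} (hFD : F.D = 0)
    {cG cF : ℕ → ℝ} (hG : IsDecaying G.contImpulse h cG) (hF : IsDecaying F.contImpulse h cF)
    (w : L2 h) (k : ℕ) :
    ((∑ j ∈ Finset.range (k + 1), systemOp G h j * pieceOp F.contImpulse h (k - j)) w : L2 h)
      =ᵐ[volume.restrict (Set.Ico (0 : ℝ) h)]
      fun θ => G.contApply (firstResponse F h w) ((k : ℝ) * h + θ) := by
  set u := firstResponse F h w with hu
  have h1 : ∀ j ∈ Finset.range (k + 1),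
      ((systemOp G h j * pieceOp F.contImpulse h (k - j)) w : L2 h)
        =ᵐ[volume.restrict (Set.Ico (0 : ℝ) h)] fun θ =>
          (∫ σ in Set.Ico (0 : ℝ) h,
            pieceKernel G.contImpulse h j θ σ * u (((k - j : ℕ) : ℝ) * h + σ)) +
          if j = 0 then ((G.D () () : ℝ) : ℂ) * u ((k : ℝ) * h + θ) else 0 := by
    intro j _
    have hp := pieceOp_ae hh hFD hF w (k - j)
    have e : (systemOp G h j * pieceOp F.contImpulse h (k - j)) w
        = pieceOp G.contImpulse h j (pieceOp F.contImpulse h (k - j) w) +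
          (if j = 0 then ((G.D () () : ℝ) : ℂ) else 0) • pieceOp F.contImpulse h (k - j) w := by
      rw [systemOp, mul_apply_eq_comp, add_apply]
      split_ifs
      · rfl
      · simp
    rw [e]
    filter_upwards [Lp.coeFn_add (pieceOp G.contImpulse h j (pieceOp F.contImpulse h (k - j) w))
      ((if j = 0 then ((G.D () () : ℝ) : ℂ) else 0) • pieceOp F.contImpulse h (k - j) w),
      Lp.coeFn_smul (if j = 0 then ((G.D () () : ℝ) : ℂ) else 0)
        (pieceOp F.contImpulse h (k - j) w),
      hG.isIntOp_pieceOp hh j (pieceOp F.contImpulse h (k - j) w), hp] with θ e1 e2 e3 e4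
    rw [e1, Pi.add_apply, e2, Pi.smul_apply, e3, e4, smul_eq_mul]
    congr 1
    · refine integral_congr_ae ?_
      filter_upwards [hp] with σ hσ
      rw [hσ]
    · split_ifs with hj
      · rw [hj, Nat.sub_zero]
      · rw [zero_mul]
  filter_upwards [coeFn_sum_apply _ _ w _ h1, ae_restrict_mem measurableSet_Ico] with θ e1 hθ
  rw [e1, Finset.sum_add_distrib, Finset.sum_ite_eq' (Finset.range (k + 1)) 0,
    if_pos (Finset.mem_range.2 (Nat.succ_pos k)), StateSpace.contApply,
    if_pos (add_nonneg (by positivity) hθ.1), add_comm]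
  congr 1
  have h2 := integral_eq_sum_pieceKernel hh hG (stronglyMeasurable_firstResponse hh hFD w)
    (exists_firstResponse_bound hh hFD hF w) k hθ
  have h3 := Finset.sum_flip (n := k) fun j => ∫ σ in Set.Ico (0 : ℝ) h,
    pieceKernel G.contImpulse h j θ σ * u (((k - j : ℕ) : ℝ) * h + σ)
  rw [← h3]
  refine Eq.trans ?_ h2.symm
  refine Finset.sum_congr rfl fun j hj => ?_
  rw [Nat.sub_sub_self (by have := Finset.mem_range.1 hj; omega)]

/-- The lifted impulse response of the digital filter with its hold, acting on constant
functions. -/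
def filterOp {n : ℕ} (S : SISO n) (h : ℝ) (L k : ℕ) : L2 h →L[ℂ] L2 h :=
  ∑ l : Fin L, (S.impulse (k * L + l) : ℂ) • blockOp h L l

theorem multirateSystem_apply (hh : 0 < h) {L : ℕ} (hL : 0 < L) (K : StableFilter) (u : ℝ → ℂ)
    (k : ℕ) {θ : ℝ} (hθ : θ ∈ Set.Ico (0 : ℝ) h) :
    multirateSystem h L K u ((k : ℝ) * h + θ) = ∑ a ∈ Finset.range (k + 1),
      (K.sys.impulse (a * L + ⌊θ / (h / L)⌋₊) : ℂ) * u (((k - a : ℕ) : ℝ) * h) := by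
  have hL' : (0 : ℝ) < L := by exact_mod_cast hL
  rw [multirateSystem, hold, if_pos (add_nonneg (by positivity) hθ.1)]
  have h1 : ⌊((k : ℝ) * h + θ) / (h / L)⌋₊ = k * L + ⌊θ / (h / L)⌋₊ := by
    have : ((k : ℝ) * h + θ) / (h / L) = θ / (h / L) + ((k * L : ℕ) : ℝ) := by
      push_cast
      field_simp
      ring
    rw [this, Nat.floor_add_natCast (by have := hθ.1; positivity), add_comm]
  rw [h1, discApply_upsample _ _ _ (floor_div_lt hh hL hθ)]
  rfl

theorem multirate_ae (hh : 0 < h) {nF : ℕ} {F : SISO nF} (hFD : F.D = 0)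
    (hF : IsDecaying F.contImpulse h c) {L : ℕ} (hL : 0 < L) (K : StableFilter) (w : L2 h)
    (k : ℕ) :
    ((∑ j ∈ Finset.range (k + 1), filterOp K.sys h L j * sampleOp F.contImpulse h (k - j)) w :
        L2 h) =ᵐ[volume.restrict (Set.Ico (0 : ℝ) h)]
      fun θ => multirateSystem h L K (firstResponse F h w) ((k : ℝ) * h + θ) := by
  set u := firstResponse F h w with hu
  have h1 : ∀ j ∈ Finset.range (k + 1),
      ((filterOp K.sys h L j * sampleOp F.contImpulse h (k - j)) w : L2 h)
        =ᵐ[volume.restrict (Set.Ico (0 : ℝ) h)] fun θ => ∑ l : Fin L,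
          (K.sys.impulse (j * L + l) : ℂ) * ((cell h L l).indicator (fun _ => 1) θ *
            u (((k - j : ℕ) : ℝ) * h)) := by
    intro j _
    have e : filterOp K.sys h L j * sampleOp F.contImpulse h (k - j) = ∑ l : Fin L,
        (K.sys.impulse (j * L + l) : ℂ) • (blockOp h L l * sampleOp F.contImpulse h (k - j)) := by
      rw [filterOp, Finset.sum_mul]
      exact Finset.sum_congr rfl fun l _ => smul_mul_assoc _ _ _
    rw [e]
    refine coeFn_sum_apply _ _ w _ fun l _ => ?_
    have e2 := ((isBddKernel_block h L l).isIntOp hh.le).mul_rankOne hh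
      (hF.isIntOp_sampleOp hh (k - j)) w
    rw [smul_apply]
    filter_upwards [e2, Lp.coeFn_smul (K.sys.impulse (j * L + l) : ℂ)
      ((blockOp h L l * sampleOp F.contImpulse h (k - j)) w)] with θ e3 e4
    rw [e4, Pi.smul_apply, smul_eq_mul]
    congr 1
    refine e3.trans ?_
    have e5 := firstResponse_eq hh hFD (w : ℝ → ℂ) (k - j) 0
    rw [add_zero] at e5
    rw [hu, e5, ← integral_const_mul]
    simp only [mul_assoc]
  filter_upwards [coeFn_sum_apply _ _ w _ h1, ae_restrict_mem measurableSet_Ico] with θ e1 hθ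
  rw [e1, multirateSystem_apply hh hL K u k hθ]
  refine Finset.sum_congr rfl fun j _ => ?_
  rw [← sum_indicator_cell hh hL (fun l => (K.sys.impulse (j * L + l) : ℂ)) hθ, Finset.sum_mul]
  refine Finset.sum_congr rfl fun l _ => ?_
  by_cases hm : θ ∈ cell h L l <;> simp [hm]

/-- The lifted impulse response of the multirate error system. -/
def errorOp {nG nF : ℕ} (G : SISO nG) (F : SISO nF) (h : ℝ) (m L : ℕ) (K : StableFilter)
    (k : ℕ) : L2 h →L[ℂ] L2 h :=
  (if m ≤ k then ∑ j ∈ Finset.range (k - m + 1),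
      systemOp G h j * pieceOp F.contImpulse h (k - m - j) else 0) -
    ∑ j ∈ Finset.range (k + 1), filterOp K.sys h L j * sampleOp F.contImpulse h (k - j)

theorem errorOp_ae (hh : 0 < h) {nG nF : ℕ} {G : SISO nG} {F : SISO nF} (hFD : F.D = 0)
    {cG cF : ℕ → ℝ} (hG : IsDecaying G.contImpulse h cG) (hF : IsDecaying F.contImpulse h cF)
    (m : ℕ) {L : ℕ} (hL : 0 < L) (K : StableFilter) (k : ℕ) (w : L2 h) :
    (errorOp G F h m L K k w : ℝ → ℂ) =ᵐ[volume.restrict (Set.Ico (0 : ℝ) h)]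
      liftedSystem h (errorSystem G F h m L K) (Pi.single 0 (w : ℝ → ℂ)) k := by
  have h1 : ((if m ≤ k then ∑ j ∈ Finset.range (k - m + 1),
      systemOp G h j * pieceOp F.contImpulse h (k - m - j) else 0 : L2 h →L[ℂ] L2 h) w : ℝ → ℂ)
      =ᵐ[volume.restrict (Set.Ico (0 : ℝ) h)] fun θ =>
        delay ((m : ℝ) * h) (G.contApply (firstResponse F h w)) ((k : ℝ) * h + θ) := by
    split_ifs with hmk
    · filter_upwards [cascade_ae hh hFD hG hF w (k - m)] with θ e1
      rw [e1, delay]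
      congr 1
      rw [Nat.cast_sub hmk]
      ring
    · rw [zero_apply]
      filter_upwards [Lp.coeFn_zero ℂ 2 (volume.restrict (Set.Ico (0 : ℝ) h)),
        ae_restrict_mem measurableSet_Ico] with θ e1 hθ
      rw [e1, delay, StateSpace.contApply, if_neg, Pi.zero_apply]
      have : (k : ℝ) + 1 ≤ m := by exact_mod_cast (by omega : k + 1 ≤ m)
      nlinarith [hθ.2]
  rw [errorOp, sub_apply]
  filter_upwards [h1, multirate_ae hh hFD hF hL K w k, Lp.coeFn_sub
    ((if m ≤ k then ∑ j ∈ Finset.range (k - m + 1),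
      systemOp G h j * pieceOp F.contImpulse h (k - m - j) else 0 : L2 h →L[ℂ] L2 h) w)
    ((∑ j ∈ Finset.range (k + 1), filterOp K.sys h L j * sampleOp F.contImpulse h (k - j)) w)]
    with θ e1 e2 e3
  rw [e3, Pi.sub_apply, e1, e2]
  rfl

end LiftedSystem

/-! ### Transfer functions and the approximation error -/

section TransferFunctions

open scoped Matrix.Norms.Operator

variable {h : ℝ} {z : ℂ}

/-- The transfer function `∑ₖ z⁻ᵏ aₖ` with impulse response `a`. -/
def zTransform {E : Type*} [NormedAddCommGroup E] [NormedSpace ℂ E] (z : ℂ) (a : ℕ → E) : E :=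
  ∑' k, (z ^ k)⁻¹ • a k

theorem hasSum_zTransform {E : Type*} [NormedAddCommGroup E] [NormedSpace ℂ E] [CompleteSpace E]
    {a : ℕ → E} (ha : Summable fun k => ‖a k‖) (hz : ‖z‖ = 1) :
    HasSum (fun k => (z ^ k)⁻¹ • a k) (zTransform z a) :=
  (Summable.of_norm (by simpa [norm_smul, hz] using ha)).hasSum

theorem norm_zTransform_le {E : Type*} [NormedAddCommGroup E] [NormedSpace ℂ E]
    {a : ℕ → E} {c : ℕ → ℝ} (hc : Summable c) (hac : ∀ k, ‖a k‖ ≤ c k) (hz : ‖z‖ = 1) :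
    ‖zTransform z a‖ ≤ ∑' k, c k :=
  tsum_of_norm_bounded hc.hasSum fun k => by simpa [norm_smul, hz] using hac k

theorem summable_norm_systemOp {n : ℕ} {G : SISO n} {c : ℕ → ℝ} (hh : 0 < h)
    (hG : IsDecaying G.contImpulse h c) : Summable fun k => ‖systemOp G h k‖ := by
  rw [← summable_nat_add_iff 1]
  simpa [systemOp] using (summable_nat_add_iff 1).2 (hG.summable_norm_pieceOp hh)

theorem zTransform_systemOp {n : ℕ} {G : SISO n} {c : ℕ → ℝ} (hh : 0 < h)
    (hG : IsDecaying G.contImpulse h c) (hz : ‖z‖ = 1) :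
    zTransform z (systemOp G h)
      = zTransform z (pieceOp G.contImpulse h) + ((G.D () () : ℝ) : ℂ) • 1 := by
  have h1 := hasSum_zTransform (hG.summable_norm_pieceOp hh) hz
  have h2 : HasSum (fun k : ℕ => (z ^ k)⁻¹ •
      (if k = 0 then ((G.D () () : ℝ) : ℂ) • 1 else 0 : L2 h →L[ℂ] L2 h))
      (((G.D () () : ℝ) : ℂ) • 1) := by
    have h3 := hasSum_ite_eq (0 : ℕ) (((G.D () () : ℝ) : ℂ) • 1 : L2 h →L[ℂ] L2 h)
    refine h3.congr_fun fun k => ?_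
    split_ifs with hk
    · rw [hk, pow_zero, inv_one, one_smul]
    · rw [smul_zero]
  have h4 := h1.add h2
  refine HasSum.tsum_eq (h4.congr_fun fun k => ?_)
  rw [systemOp, smul_add]

theorem summable_polyphase {K : StableFilter} {L : ℕ} (hL : 0 < L) (l : ℕ) :
    Summable fun k : ℕ => |K.sys.impulse (k * L + l)| :=
  K.stable.summable_abs_impulse.comp_injective (i := fun k : ℕ => k * L + l) fun _ _ hab =>
    Nat.eq_of_mul_eq_mul_right hL (Nat.add_right_cancel hab)

theorem summable_norm_filterOp {K : StableFilter} {L : ℕ} (hL : 0 < L) :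
    Summable fun k => ‖filterOp K.sys h L k‖ := by
  refine Summable.of_nonneg_of_le (fun _ => norm_nonneg _)
    (f := fun k => ∑ l : Fin L, |K.sys.impulse (k * L + l)| * ‖blockOp h L l‖) (fun k => ?_) ?_
  · refine norm_sum_le_of_le _ fun l _ => ?_
    rw [norm_smul, Complex.norm_real, Real.norm_eq_abs]
  · exact summable_sum fun l _ => (summable_polyphase hL l).mul_right _

/-- The entries of `K̃` are the transfer functions of the polyphase components of `K`. -/
theorem hasSum_Ktilde {K : StableFilter} {L : ℕ} (hL : 0 < L) (hz : ‖z‖ = 1) (l : Fin L) :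
    HasSum (fun k : ℕ => (z ^ k)⁻¹ * (K.sys.impulse (k * L + l) : ℂ)) (Ktilde L K z l ()) := by
  have hA : Summable fun k : ℕ => ‖(K.sys.A ^ L) ^ k‖ := by
    simp only [← pow_mul]
    exact K.stable.summable_norm_pow.comp_injective fun _ _ hab =>
      Nat.eq_of_mul_eq_mul_left hL hab
  have h1 := K.sys.hasSum_lift_transfer hA hz l ⟨0, hL⟩
  have h2 : Ktilde L K z l () = (K.sys.lift L).transfer z l ⟨0, hL⟩ := by
    rw [Ktilde, Matrix.mul_apply, Finset.sum_eq_single ⟨0, hL⟩]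
    · simp [SN]
    · intro j _ hj
      have : (j : ℕ) ≠ 0 := fun h0 => hj (Fin.ext h0)
      simp [SN, this]
    · simp
  rw [h2]
  simpa [toeplitz] using h1

theorem zTransform_filterOp {K : StableFilter} {L : ℕ} (hL : 0 < L) (hz : ‖z‖ = 1) :
    zTransform z (filterOp K.sys h L) = ∑ l : Fin L, Ktilde L K z l () • blockOp h L l := by
  have h1 : HasSum (fun k : ℕ => ∑ l : Fin L,
      ((z ^ k)⁻¹ * (K.sys.impulse (k * L + l) : ℂ)) • blockOp h L l)
      (∑ l : Fin L, Ktilde L K z l () • blockOp h L l) :=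
    hasSum_sum fun l _ => (hasSum_Ktilde hL hz l).smul_const _
  refine HasSum.tsum_eq (h1.congr_fun fun k => ?_)
  rw [filterOp, Finset.smul_sum]
  exact Finset.sum_congr rfl fun l _ => smul_smul _ _ _

/-- The value at `z` of the transfer function of the lifted multirate error system. -/
def errorTransfer {nG nF : ℕ} (G : SISO nG) (F : SISO nF) (h : ℝ) (m L : ℕ) (K : StableFilter)
    (z : ℂ) : L2 h →L[ℂ] L2 h :=
  (z ^ m)⁻¹ • (zTransform z (systemOp G h) * zTransform z (pieceOp F.contImpulse h)) -
    zTransform z (filterOp K.sys h L) * zTransform z (sampleOp F.contImpulse h)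

theorem hasSum_delay_cauchyProduct_sub {R : Type*} [NormedRing R] [NormedAlgebra ℂ R]
    [CompleteSpace R] {a b a' b' : ℕ → R} (hz : ‖z‖ = 1)
    (ha : Summable fun k => ‖a k‖) (hb : Summable fun k => ‖b k‖)
    (ha' : Summable fun k => ‖a' k‖) (hb' : Summable fun k => ‖b' k‖) (m : ℕ) :
    HasSum (fun k => (z ^ k)⁻¹ • ((if m ≤ k then
        ∑ j ∈ Finset.range (k - m + 1), a j * b (k - m - j) else 0) -
          ∑ j ∈ Finset.range (k + 1), a' j * b' (k - j)))
      ((z ^ m)⁻¹ • (zTransform z a * zTransform z b) - zTransform z a' * zTransform z b') := by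
  have h1 := hasSum_delay (E := R)
    (a := fun k => ∑ j ∈ Finset.range (k + 1), a j * b (k - j)) (z := z)
    (hasSum_cauchyProduct hz ha hb (hasSum_zTransform ha hz) (hasSum_zTransform hb hz)) m
  have h2 := hasSum_cauchyProduct hz ha' hb' (hasSum_zTransform ha' hz) (hasSum_zTransform hb' hz)
  refine (h1.sub h2).congr_fun fun k => ?_
  rw [smul_sub]

theorem hasSum_errorTransfer (hh : 0 < h) {nG nF : ℕ} {G : SISO nG} {F : SISO nF}
    {cG cF : ℕ → ℝ} (hG : IsDecaying G.contImpulse h cG) (hF : IsDecaying F.contImpulse h cF)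
    (m : ℕ) {L : ℕ} (hL : 0 < L) (K : StableFilter) (hz : ‖z‖ = 1) :
    HasSum (fun k => (z ^ k)⁻¹ • errorOp G F h m L K k) (errorTransfer G F h m L K z) :=
  hasSum_delay_cauchyProduct_sub hz (summable_norm_systemOp hh hG) (hF.summable_norm_pieceOp hh)
    (summable_norm_filterOp hL) (hF.summable_norm_sampleOp hh) m

section FastSampling

variable {n : ℕ} {S : SISO n} {c : ℕ → ℝ} {N : ℕ}

theorem hasSum_fastSampled_transfer (hh : 0 < h) (hS : S.IsHurwitz) (hN : 0 < N) (hz : ‖z‖ = 1)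
    (i j : Fin N) :
    HasSum (fun k : ℕ => (z ^ k)⁻¹ * toeplitz (S.c2d (h / N)).impulse (k * N + i) j)
      (((S.c2d (h / N)).lift N).transfer z i j) := by
  refine StateSpace.hasSum_lift_transfer _ ?_ hz i j
  have hN' : (N : ℝ) ≠ 0 := by exact_mod_cast hN.ne'
  have h1 : (S.c2d (h / N)).A ^ N = NormedSpace.exp (h • S.A) := by
    rw [StateSpace.c2d, ← exp_natCast_mul_smul]
    congr 2
    field_simp
  rw [h1]
  exact hS.summable_norm_exp_pow hh

theorem norm_stepOp_fastSampled_sub_le (hh : 0 < h) (hS : S.IsHurwitz) (hSD : S.D = 0)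
    (hc : IsDecaying S.contImpulse h c) (hN : 0 < N) (hz : ‖z‖ = 1) :
    ‖stepOp h (((S.c2d (h / N)).lift N).transfer z) - zTransform z (pieceOp S.contImpulse h)‖
      ≤ samplingError h N * ∑' k, c k := by
  have hη0 : (S.c2d (h / N)).impulse 0 = 0 := by simp [StateSpace.impulse, StateSpace.c2d, hSD]
  refine norm_stepOp_sub_le hh hN (hc.isBddKernel hh) hc.summable (hc.nonneg hh) hz
    (g := fun k i j => toeplitz (S.c2d (h / N)).impulse (k * N + i) j) ?_
    (hasSum_fastSampled_transfer hh hS hN hz) (hasSum_zTransform (hc.summable_norm_pieceOp hh) hz)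
  intro k θ hθ
  exact ⟨⟨_, floor_div_lt hh hN hθ⟩, fun τ hτ =>
    hc.norm_pieceKernel_sub_toeplitz_le hh hN hη0 (fun m => S.impulse_c2d_succ _ m) k hθ hτ⟩

/-- The square matrix all of whose rows are the first row of `M`. -/
def firstRow (hN : 0 < N) (M : Matrix (Fin N) (Fin N) ℂ) : Matrix (Fin N) (Fin N) ℂ :=
  Matrix.of fun _ j => M ⟨0, hN⟩ j

theorem norm_stepOp_firstRow_sub_le (hh : 0 < h) (hS : S.IsHurwitz) (hSD : S.D = 0)
    (hc : IsDecaying S.contImpulse h c) (hN : 0 < N) (hz : ‖z‖ = 1) :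
    ‖stepOp h (firstRow hN (((S.c2d (h / N)).lift N).transfer z)) -
        zTransform z (sampleOp S.contImpulse h)‖
      ≤ samplingError h N * ∑' k, c k := by
  have hη0 : (S.c2d (h / N)).impulse 0 = 0 := by simp [StateSpace.impulse, StateSpace.c2d, hSD]
  refine norm_stepOp_sub_le hh hN (fun k => (hc.isBddKernel hh k).freeze hh) hc.summable
    (hc.nonneg hh) hz
    (g := fun k _ j => toeplitz (S.c2d (h / N)).impulse (k * N) j) ?_
    (fun i j => ?_) (hasSum_zTransform (hc.summable_norm_sampleOp hh) hz)
  · intro k θ hθ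
    refine ⟨⟨0, hN⟩, fun τ hτ => ?_⟩
    have := hc.norm_pieceKernel_sub_toeplitz_le hh hN hη0 (fun m => S.impulse_c2d_succ _ m) k
      ⟨le_rfl, hh⟩ hτ
    simpa using this
  · exact hasSum_fastSampled_transfer hh hS hN hz ⟨0, hN⟩ j

/-- The direct term contributes the same multiple of the identity to the lifted transfer function
of the fast-sampled system. -/
theorem fastSampled_transfer_eq (S : SISO n) (δ : ℝ) (N : ℕ) (z : ℂ) :
    ((S.c2d δ).lift N).transfer z
      = ((StateSpace.c2d { S with D := 0 } δ).lift N).transfer z + ((S.D () () : ℝ) : ℂ) • 1 := by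
  ext i j
  have h1 : toC ((S.c2d δ).lift N).D i j
      = toC ((StateSpace.c2d { S with D := 0 } δ).lift N).D i j +
        (((S.D () () : ℝ) : ℂ) • (1 : Matrix (Fin N) (Fin N) ℂ)) i j := by
    simp only [toC, StateSpace.lift, StateSpace.c2d, Matrix.map_apply, Matrix.of_apply,
      Matrix.smul_apply, Matrix.one_apply, Matrix.zero_apply, smul_eq_mul]
    rcases lt_trichotomy (j : ℕ) i with h | h | h
    · have h' : ¬ i = j := fun e => by rw [e] at h; exact lt_irrefl _ h
      simp [h, h']
    · have : j = i := Fin.ext h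
      simp [this]
    · have h' : ¬ j = i := fun e => by rw [e] at h; exact lt_irrefl _ h
      have h'' : ¬ i = j := fun e => h' e.symm
      simp [h.not_gt, h', h'']
  rw [StateSpace.transfer, StateSpace.transfer, Matrix.add_apply, Matrix.add_apply,
    Matrix.add_apply, h1, ← add_assoc]
  rfl

end FastSampling

/-- The zero-order hold of the slow grid maps the first sample to a step function that is constant
on each of the `L` blocks. -/
theorem stepOp_hold_mul (hh : 0 < h) {L p : ℕ} (hL : 0 < L) (hp : 0 < p) (hN : 0 < L * p)
    (v : Matrix (Fin L) Unit ℂ) (M : Matrix (Fin (L * p)) (Fin (L * p)) ℂ) :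
    stepOp h (HtildeN L p * v * SN (L * p) * M)
      = (∑ l : Fin L, v l () • blockOp h L l) * stepOp h (firstRow hN M) := by
  set R : Fin L → Matrix (Fin (L * p)) (Fin (L * p)) ℂ := fun l =>
    Matrix.of fun i j => (if (i : ℕ) / p = l then 1 else 0) * M ⟨0, hN⟩ j with hR
  have h1 : HtildeN L p * v * SN (L * p) * M = ∑ l : Fin L, v l () • R l := by
    ext i j
    rw [Matrix.mul_assoc (HtildeN L p * v), Matrix.mul_apply, Fintype.sum_unique,
      Matrix.mul_apply, Matrix.mul_apply, Matrix.sum_apply, Finset.sum_mul]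
    have h2 : ∑ x, SN (L * p) default x * M x j = M ⟨0, hN⟩ j := by
      rw [Finset.sum_eq_single ⟨0, hN⟩]
      · simp [SN]
      · intro x _ hx
        have : (x : ℕ) ≠ 0 := fun h0 => hx (Fin.ext h0)
        simp [SN, this]
      · simp
    rw [h2]
    refine Finset.sum_congr rfl fun l _ => ?_
    simp only [HtildeN, hR, Matrix.of_apply, Matrix.smul_apply, smul_eq_mul]
    ring
  have h3 : ∀ l : Fin L, stepOp h (R l) = blockOp h L l * stepOp h (firstRow hN M) := by
    intro l
    set r : ℕ → ℂ := fun j => if hj : j < L * p then M ⟨0, hN⟩ ⟨j, hj⟩ else 0 with hr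
    have hrj : ∀ j : Fin (L * p), M ⟨0, hN⟩ j = r j := fun j => by simp [hr]
    have k1 := isIntOp_stepOp hh hN (R l)
      (fun i j => (if i / p = (l : ℕ) then 1 else 0) * r j) (fun i j => by simp [hR, hrj])
    have k2 := isIntOp_stepOp hh hN (firstRow hN M) (fun _ j => r j) (fun i j => hrj j)
    have k3 := ((isBddKernel_block h L l).isIntOp hh.le).mul_rankOne hh k2
    refine k1.unique (k3.congr fun θ hθ τ _ => ?_)
    have hfl : ⌊θ / (h / (L * p : ℕ))⌋₊ / p = ⌊θ / (h / L)⌋₊ := by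
      have hp' : (p : ℝ) ≠ 0 := by exact_mod_cast hp.ne'
      have hL' : (L : ℝ) ≠ 0 := by exact_mod_cast hL.ne'
      rw [← Nat.floor_div_natCast]
      congr 1
      push_cast
      field_simp
    rw [hfl]
    by_cases hm : θ ∈ cell h L l
    · rw [Set.indicator_of_mem hm, if_pos ((mem_cell_iff hh hL hθ.1).1 hm)]
      ring
    · rw [Set.indicator_of_notMem hm, if_neg fun e => hm ((mem_cell_iff hh hL hθ.1).2 e)]
      ring
  rw [h1, ← stepOpLin_apply, map_sum, Finset.sum_mul]
  refine Finset.sum_congr rfl fun l _ => ?_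
  rw [map_smul, stepOpLin_apply, h3, smul_mul_assoc]

theorem norm_mul_sub_mul_le {R : Type*} [NormedRing R] {x x' y y' : R} {a b α β : ℝ}
    (hx : ‖x' - x‖ ≤ α) (hy : ‖y' - y‖ ≤ β) (hxa : ‖x‖ ≤ a) (hyb : ‖y‖ ≤ b) :
    ‖x' * y' - x * y‖ ≤ α * (b + β) + a * β := by
  have hy' : ‖y'‖ ≤ b + β := by
    calc ‖y'‖ = ‖y + (y' - y)‖ := by rw [add_sub_cancel]
      _ ≤ b + β := (norm_add_le _ _).trans (add_le_add hyb hy)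
  have h1 : x' * y' - x * y = (x' - x) * y' + x * (y' - y) := by noncomm_ring
  rw [h1]
  refine (norm_add_le _ _).trans (add_le_add ?_ ?_)
  · exact (norm_mul_le _ _).trans (mul_le_mul hx hy' (norm_nonneg _) ((norm_nonneg _).trans hx))
  · exact (norm_mul_le _ _).trans (mul_le_mul hxa hy (norm_nonneg _) ((norm_nonneg _).trans hxa))

/-- The error of the fast sample/hold approximation, bounded uniformly on the unit circle. The
filter enters only through a bound `q` for the entries of `K̃`. -/
theorem abs_specNorm_sub_le (hh : 0 < h) {nG nF : ℕ} {G : SISO nG} {F : SISO nF}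
    (hG : G.IsHurwitz) (hF : F.IsHurwitz) (hFD : F.D = 0) {cG cF : ℕ → ℝ}
    (hcG : IsDecaying G.contImpulse h cG) (hcF : IsDecaying F.contImpulse h cF)
    (m : ℕ) {L p : ℕ} (hL : 0 < L) (hp : 0 < p) {K : StableFilter} (hz : ‖z‖ = 1) {q : ℝ}
    (hq : ∀ l, ‖Ktilde L K z l ()‖ ≤ q) :
    |specNorm (approxError G F h m L p K z) - ‖errorTransfer G F h m L K z‖| ≤
      samplingError h (L * p) * (∑' k, cG k) *
          (h * (∑' k, cF k) + samplingError h (L * p) * ∑' k, cF k) +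
        (h * (∑' k, cG k) + |G.D () ()|) * (samplingError h (L * p) * ∑' k, cF k) +
        (∑ l : Fin L, q * ‖blockOp h L l‖) * (samplingError h (L * p) * ∑' k, cF k) := by
  have hN : 0 < L * p := Nat.mul_pos hL hp
  set N := L * p with hNdef
  set s := samplingError h N with hs
  set GN := ((G.c2d (h / N)).lift N).transfer z with hGN
  set FN := ((F.c2d (h / N)).lift N).transfer z with hFN
  set G₀ : SISO nG := { G with D := 0 } with hG₀
  set GN₀ := ((G₀.c2d (h / N)).lift N).transfer z with hGN₀
  have hd : ((G.D () () : ℝ) : ℂ) • (1 : Matrix (Fin N) (Fin N) ℂ) * FN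
      = ((G.D () () : ℝ) : ℂ) • FN := by rw [Matrix.smul_mul, one_mul]
  -- the direct term acts on step functions as a multiple of the identity of `L²[0, h)`, because
  -- the range of `stepOp h FN` consists of step functions
  have e1 : stepOp h (GN * FN)
      = (stepOp h GN₀ + ((G.D () () : ℝ) : ℂ) • 1) * stepOp h FN := by
    rw [hGN, fastSampled_transfer_eq, add_mul, hd, ← stepOpLin_apply, map_add, map_smul,
      stepOpLin_apply, stepOpLin_apply, stepOp_mul hh, add_mul, smul_mul_assoc, one_mul]
  have e2 : stepOp h (approxError G F h m L p K z)
      = (z ^ m)⁻¹ • ((stepOp h GN₀ + ((G.D () () : ℝ) : ℂ) • 1) * stepOp h FN) -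
        (∑ l : Fin L, Ktilde L K z l () • blockOp h L l) * stepOp h (firstRow hN FN) := by
    rw [approxError, sub_mul, ← stepOpLin_apply, map_sub, stepOpLin_apply, stepOpLin_apply,
      stepOp_hold_mul hh hL hp hN, Matrix.smul_mul, ← e1, ← stepOpLin_apply, map_smul,
      stepOpLin_apply]
  have b1 : ‖(stepOp h GN₀ + ((G.D () () : ℝ) : ℂ) • 1) - zTransform z (systemOp G h)‖
      ≤ s * ∑' k, cG k := by
    rw [zTransform_systemOp hh hcG hz, add_sub_add_right_eq_sub]
    exact norm_stepOp_fastSampled_sub_le (S := G₀) hh hG rfl hcG hN hz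
  have b2 : ‖stepOp h FN - zTransform z (pieceOp F.contImpulse h)‖ ≤ s * ∑' k, cF k :=
    norm_stepOp_fastSampled_sub_le hh hF hFD hcF hN hz
  have b3 : ‖stepOp h (firstRow hN FN) - zTransform z (sampleOp F.contImpulse h)‖
      ≤ s * ∑' k, cF k :=
    norm_stepOp_firstRow_sub_le hh hF hFD hcF hN hz
  have b4 : ‖zTransform z (systemOp G h)‖ ≤ h * (∑' k, cG k) + |G.D () ()| := by
    rw [zTransform_systemOp hh hcG hz]
    refine (norm_add_le _ _).trans (add_le_add ?_ ?_)
    · rw [← tsum_mul_left]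
      exact norm_zTransform_le (hcG.summable.mul_left h) (hcG.norm_pieceOp_le hh) hz
    · rw [norm_smul, Complex.norm_real, Real.norm_eq_abs]
      exact mul_le_of_le_one_right (abs_nonneg _) ContinuousLinearMap.norm_id_le
  have b5 : ‖zTransform z (pieceOp F.contImpulse h)‖ ≤ h * ∑' k, cF k := by
    rw [← tsum_mul_left]
    exact norm_zTransform_le (hcF.summable.mul_left h) (hcF.norm_pieceOp_le hh) hz
  have b6 : ‖∑ l : Fin L, Ktilde L K z l () • blockOp h L l‖
      ≤ ∑ l : Fin L, q * ‖blockOp h L l‖ :=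
    norm_sum_le_of_le _ fun l _ => by
      rw [norm_smul]
      exact mul_le_mul_of_nonneg_right (hq l) (norm_nonneg _)
  have b7 := norm_mul_sub_mul_le b1 b2 b4 b5
  rw [← norm_stepOp hh]
  refine (abs_norm_sub_norm_le _ _).trans ?_
  have e3 : stepOp h (approxError G F h m L p K z) - errorTransfer G F h m L K z
      = (z ^ m)⁻¹ • ((stepOp h GN₀ + ((G.D () () : ℝ) : ℂ) • 1) * stepOp h FN -
          zTransform z (systemOp G h) * zTransform z (pieceOp F.contImpulse h)) -
        (∑ l : Fin L, Ktilde L K z l () • blockOp h L l) *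
          (stepOp h (firstRow hN FN) - zTransform z (sampleOp F.contImpulse h)) := by
    rw [e2, errorTransfer, zTransform_filterOp hL hz, smul_sub, mul_sub]
    abel
  rw [e3]
  refine (norm_sub_le _ _).trans (add_le_add ?_ ?_)
  · rw [norm_smul, norm_inv, norm_pow, hz, one_pow, inv_one, one_mul]
    exact b7
  · exact (norm_mul_le _ _).trans (mul_le_mul b6 b3 (norm_nonneg _) ((norm_nonneg _).trans b6))

/-- A set of stable filters that is compact in the `H^∞` norm is bounded in it. -/
theorem exists_norm_Ktilde_le {L : ℕ} (hL : 0 < L) {𝒦 : Set StableFilter}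
    (h𝒦 : IsCompactFilterSet L 𝒦) :
    ∃ q, ∀ K ∈ 𝒦, ∀ z : ℂ, ‖z‖ = 1 → ∀ l, ‖Ktilde L K z l ()‖ ≤ q := by
  have hone : ∀ K : StableFilter, ∀ z : Circle, ∀ l : Fin L,
      ‖Ktilde L K z l ()‖ ≤ ∑' k, |K.sys.impulse k| := by
    intro K z l
    have h1 := hasSum_Ktilde (K := K) hL (Circle.norm_coe z) l
    refine (h1.norm_le_of_bounded (summable_polyphase (K := K) hL l).hasSum fun k => ?_).trans ?_
    · rw [norm_mul, norm_inv, norm_pow, Circle.norm_coe, one_pow, inv_one, one_mul,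
        Complex.norm_real, Real.norm_eq_abs]
    · exact tsum_comp_le_tsum_of_inj K.stable.summable_abs_impulse (fun _ => abs_nonneg _)
        (i := fun k : ℕ => k * L + l) fun _ _ hab =>
          Nat.eq_of_mul_eq_mul_right hL (Nat.add_right_cancel hab)
  have hV : UniformFun.gen Circle (Fin L → ℂ) {x | dist x.1 x.2 < 1} ∈
      uniformity (UniformFun Circle (Fin L → ℂ)) :=
    (UniformFun.hasBasis_uniformity Circle (Fin L → ℂ)).mem_of_mem
      (Metric.dist_mem_uniformity one_pos)
  obtain ⟨t, hts, htf, hcov⟩ := totallyBounded_iff_subset.1 h𝒦.totallyBounded _ hV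
  obtain ⟨s, hs𝒦, hsf, rfl⟩ := (Set.exists_subset_image_finite_and
    (p := fun t' => t' = t)).1 ⟨t, hts, htf, rfl⟩
  obtain ⟨b, hb⟩ := (hsf.image fun K : StableFilter => ∑' k, |K.sys.impulse k|).bddAbove
  -- every filter of the set is within distance one of a filter of the finite set `s`
  refine ⟨1 + b, fun K hK z hz l => ?_⟩
  have h1 := hcov (Set.mem_image_of_mem _ hK)
  simp only [Set.mem_iUnion, exists_prop, Set.mem_ofPred_eq] at h1
  obtain ⟨_, ⟨K', hK', rfl⟩, hd⟩ := h1
  have h2 := hd ⟨z, mem_sphere_zero_iff_norm.2 hz⟩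
  have h3 : ‖Ktilde L K z l () - Ktilde L K' z l ()‖ < 1 := by
    rw [← dist_eq_norm]
    exact (dist_le_pi_dist (fun l : Fin L => Ktilde L K z l ())
      (fun l : Fin L => Ktilde L K' z l ()) l).trans_lt h2
  have h4 := hone K' ⟨z, mem_sphere_zero_iff_norm.2 hz⟩ l
  have h5 := hb (Set.mem_image_of_mem _ hK')
  calc ‖Ktilde L K z l ()‖
      = ‖(Ktilde L K z l () - Ktilde L K' z l ()) + Ktilde L K' z l ()‖ := by
        rw [sub_add_cancel]
    _ ≤ 1 + b := (norm_add_le _ _).trans (add_le_add h3.le (h4.trans h5))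

theorem norm_freqPoint (h ω : ℝ) : ‖freqPoint h ω‖ = 1 := Complex.norm_exp_ofReal_mul_I _

theorem tendstoUniformlyOn_specNorm (hh : 0 < h) {nG nF : ℕ} {G : SISO nG} {F : SISO nF}
    (hG : G.IsHurwitz) (hF : F.IsHurwitz) (hFD : F.D = 0) (m : ℕ) {L : ℕ} (hL : 0 < L)
    {𝒦 : Set StableFilter} (h𝒦 : IsCompactFilterSet L 𝒦) (Ω : Set ℝ) :
    TendstoUniformlyOn
      (fun (p : ℕ) (q : StableFilter × ℝ) =>
        specNorm (approxError G F h m L p q.1 (freqPoint h q.2)))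
      (fun q => ‖errorTransfer G F h m L q.1 (freqPoint h q.2)‖) atTop (𝒦 ×ˢ Ω) := by
  obtain ⟨cG, hcG⟩ := hG.exists_isDecaying hh
  obtain ⟨cF, hcF⟩ := hF.exists_isDecaying hh
  obtain ⟨b, hb⟩ := exists_norm_Ktilde_le hL h𝒦
  have hs : Tendsto (fun p : ℕ => samplingError h (L * p)) atTop (𝓝 0) :=
    (tendsto_samplingError h).comp (tendsto_id.const_mul_atTop' hL)
  have hcont : Continuous fun s : ℝ =>
      s * (∑' k, cG k) * (h * (∑' k, cF k) + s * ∑' k, cF k) +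
        (h * (∑' k, cG k) + |G.D () ()|) * (s * ∑' k, cF k) +
        (∑ l : Fin L, b * ‖blockOp h L l‖) * (s * ∑' k, cF k) := by fun_prop
  have hlim := (hcont.tendsto 0).comp hs
  simp only [zero_mul, mul_zero, add_zero] at hlim
  rw [Metric.tendstoUniformlyOn_iff]
  intro ε hε
  filter_upwards [hlim.eventually (gt_mem_nhds hε), eventually_gt_atTop 0] with p hp1 hp0
  rintro ⟨K, ω⟩ ⟨hK, -⟩
  rw [dist_comm, Real.dist_eq]
  exact (abs_specNorm_sub_le hh hG hF hFD hcG hcF m hL hp0 (norm_freqPoint h ω)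
    (hb K hK _ (norm_freqPoint h ω))).trans_lt hp1

end TransferFunctions

end Multirate

end

theorem theorem2 {nG nF : ℕ} (G : Multirate.SISO nG) (F : Multirate.SISO nF)
    (hG : G.IsHurwitz) (hF : F.IsHurwitz) (hFD : F.D = 0)
    (h : ℝ) (hh : 0 < h) (m L : ℕ) (hL : 1 ≤ L) :
    ∃ T : Multirate.StableFilter → ℝ → (Multirate.L2 h →L[ℂ] Multirate.L2 h),
      (∀ (K : Multirate.StableFilter) (ω : ℝ),
        Multirate.IsLiftedTransfer h (Multirate.errorSystem G F h m L K)
          (Multirate.freqPoint h ω) (T K ω)) ∧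
      (∀ (K : Multirate.StableFilter), ∀ ω ∈ Set.Ico (0 : ℝ) (2 * Real.pi / h),
        Tendsto
          (fun p : ℕ => Multirate.specNorm
            (Multirate.approxError G F h m L p K (Multirate.freqPoint h ω)))
          atTop (𝓝 ‖T K ω‖)) ∧
      (∀ 𝒦 : Set Multirate.StableFilter, Multirate.IsCompactFilterSet L 𝒦 →
        TendstoUniformlyOn
          (fun (p : ℕ) (q : Multirate.StableFilter × ℝ) => Multirate.specNorm
            (Multirate.approxError G F h m L p q.1 (Multirate.freqPoint h q.2)))
          (fun q => ‖T q.1 q.2‖) atTop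
          (𝒦 ×ˢ Set.Ico (0 : ℝ) (2 * Real.pi / h))) := by
  obtain ⟨cG, hcG⟩ := hG.exists_isDecaying hh
  obtain ⟨cF, hcF⟩ := hF.exists_isDecaying hh
  refine ⟨fun K ω => Multirate.errorTransfer G F h m L K (Multirate.freqPoint h ω),
    fun K ω => ⟨Multirate.errorOp G F h m L K, fun k w =>
      Multirate.errorOp_ae hh hFD hcG hcF m hL K k w,
      Multirate.hasSum_errorTransfer hh hcG hcF m hL K (Multirate.norm_freqPoint h ω)⟩,
    fun K ω hω => ?_, fun 𝒦 h𝒦 =>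
      Multirate.tendstoUniformlyOn_specNorm hh hG hF hFD m hL h𝒦 _⟩
  -- the pointwise statement is the uniform one for a single filter
  have h𝒦 : Multirate.IsCompactFilterSet L {K} := by
    rw [Multirate.IsCompactFilterSet, Set.image_singleton]
    exact isCompact_singleton
  exact (Multirate.tendstoUniformlyOn_specNorm hh hG hF hFD m hL h𝒦 _).tendsto_at
    (x := (K, ω)) ⟨rfl, hω⟩
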